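/- **Arrays.** For positive integers $K,F$, an $F\times K$ array with entries in $\{*\}\cup\{0,\dots,S-1\}$ is a $(K,F,Z,S)$ *secure placement delivery array* (SPDA) if (C1) $*$ appears exactly $Z$ times in each column; (C2) each symbol $s$ appears at least four times; (C3) for each symbol $s$, the rows and columns containing $s$ form, up to row and column permutations, a $(g+1)\times g$ subarray whose first row is constantly $s$ and whose other $g$ rows form a $g\times g$ array with $s$ on the diagonal and $*$ off the diagonal. It is *optimal* if $S$ is the least possible for the given $K,F,Z$. **Schemes.** Let $\mathbf P=(p_{j,k})$ be a $(K,F,Z,S)$ SPDA, $N\ge K$ and $b\ge1$. There are $N$ files $W_0,\dots,W_{N-1}$, each consisting of $F$ packets of $b$ bits. All file bits are independent and uniform; for each file $n$ the server draws a uniform permutation $\phi_n$ of $\{0,\dots,F-1\}$, the $j$-th packet of $W_n$ carrying the index $\phi_n(j)$; for each $s$ it draws a uniform $b$-bit key $T_s$; the demand vector $\mathbf d=(d_0,\dots,d_{K-1})$ is uniform among the vectors in $\{0,\dots,N-1\}^K$ with pairwise different entries; all of these are independent. Let $\mathcal U_s$ be the set of columns containing $s$ and $j^{(s)}$ the row containing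 $s$ at least twice. In the scheme realized by $\mathbf P$, user $k$ stores the keys $T_s$ with $k\in\mathcal U_s$ and the set $\mathcal Z_k$ of the $j$-th packets of all files (together with the indices they carry) for all $j$ with $p_{j,k}=*$ or with $p_{j,k}=s$ and $j=j^{(s)}$ for some $s$. For each $s$ the server sends to the group $\mathcal U_s$ the encrypted signal $T_s\oplus X_s$, where $X_s$ is the XOR of the $j$-th packets of $W_{d_k}$ over all $(j,k)$ with $p_{j,k}=s$, $j\ne j^{(s)}$, and of the $j^{(s)}$-th packets of all files not demanded in $\mathcal U_s$; its header lists the indices carried by these packets. Such a scheme is an *$F$-division $(K,M,N)$ secure coded caching scheme with rate $R$* if every user caches exactly $MF$ packets, $0<M<N$, $R=S/F$, the groups $\mathcal U_s$ are pairwise different, each user has $F(1-M/N)$ keys, and for every user $k$: * $W_{d_k}$ has conditional entropy $0$ given $\mathcal Z_k$, the keys of $k$, the encrypted signals with headers sent to $k$, $\phi_{d_k}$ and $d_k$; * $I\big(\mathbf d_{-k};\,(X_s\text{ with header})_{s:\,k\in\mathcal U_s}\,\big|\,\phi_{d_k},\mathcal Z_k,d_k\big)=0$, where $\mathbf d_{-k}$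 are the demands of the other users; * the bits (without indices) of the cached packets, of the keys and of the signals $X_s$ with $k\in\mathcal U_s$ have mutual information $0$ with $(\phi_n)_n$; and, against wiretappers, all encrypted signals with headers together have mutual information $0$ with the files. **Theorem.** Let $K,t$ be positive integers with $(t+1)\mid K$, and put $$F=\frac{2K-t}{K-t}\binom{K-1}{t},\qquad Z=\binom{K-1}{t-1},\qquad S=\binom{K}{t+1}.$$ Then $F$ is an integer, and the $(t+1)$-subsets of $[0,K)=\{0,\dots,K-1\}$ can be partitioned into $\binom{K-1}{t}$ parallel classes $\mathcal D_i$ (each consisting of pairwise disjoint sets with union $[0,K)$). For every such partition let $\mathbf Q'$ be the $\binom{K-1}{t}\times K$ array whose entry in row $\mathcal D_i$ and column $k$ is the block of $\mathcal D_i$ containing $k$, and let $\mathbf Q$ be the $\binom Kt\times K$ array, with rows indexed by the $t$-subsets $A$ of $[0,K)$, whose entry in row $A$ and column $k$ is $A\cup\{k\}$ if $k\notin A$ and $*$ otherwise. Then, however the rows and the $(t+1)$-subsets are numbered, stacking $\mathbf Q'$ over $\mathbf Q$ gives an optimal $(K,F,Z,S)$ SPDA $\mathbf P$, and it meets the bound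 $$S=\frac{K(F-Z)}{2+2K-\frac{2K(F-Z)}{F+Z}}.$$ For all $N\ge K$ and $b\ge 1$ the scheme realized by $\mathbf P$ is an $F$-division $(K,M,N)$ secure coded caching scheme with $$\frac MN=\frac{K}{2K-t},\qquad R=\frac{K-t}{t+1}\cdot\frac{K}{2K-t}.$$ -/

import Mathlib

namespace SecureCaching

/-! ### Secure placement delivery arrays -/

/-- An `F × K` array with entries in `{*} ∪ [0,S)`; the star is `none`. -/
abbrev PArray (K F S : ℕ) : Type := Fin F → Fin K → Option (Fin S)

/-- `P` is a `(K,F,Z,S)` secure placement delivery array. -/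
structure IsSPDA (K F Z S : ℕ) (P : PArray K F S) : Prop where
  pos_K : 0 < K
  pos_F : 0 < F
  /-- the star appears `Z` times in each column -/
  stars : ∀ k, (Finset.univ.filter fun j => P j k = none).card = Z
  /-- each symbol appears at least four times -/
  four_le : ∀ s, 4 ≤ (Finset.univ.filter fun p : Fin F × Fin K => P p.1 p.2 = some s).card
  /-- The rows having `s` are `j₀, r 0, …, r (g-1)` (all different), the columns having `s` are
  `c 0, …, c (g-1)` (all different). Row `j₀` is constantly `s` on these columns; below it `s` stands
  on the diagonal and stars stand off the diagonal. -/
  subarray : ∀ s, ∃ (g : ℕ) (j₀ : Fin F) (r : Fin g → Fin F) (c : Fin g → Fin K),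
    Function.Injective r ∧ Function.Injective c ∧ j₀ ∉ Set.range r ∧
    {j | ∃ k, P j k = some s} = insert j₀ (Set.range r) ∧
    {k | ∃ j, P j k = some s} = Set.range c ∧
    (∀ i, P j₀ (c i) = some s) ∧
    (∀ i, P (r i) (c i) = some s) ∧
    (∀ i l, i ≠ l → P (r i) (c l) = none)

/-- An SPDA with the least number `S` of symbols for its parameters `K`, `F`, `Z`. -/
def IsOptimalSPDA (K F Z S : ℕ) (P : PArray K F S) : Prop :=
  IsSPDA K F Z S P ∧ ∀ (S' : ℕ) (P' : PArray K F S'), IsSPDA K F Z S' P' → S ≤ S'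

/-- The lower bound `K(F-Z) / (2 + 2K - 2K(F-Z)/(F+Z))` for the number of symbols of an SPDA. -/
noncomputable def spdaLowerBound (K F Z : ℕ) : ℝ :=
  (K : ℝ) * ((F : ℝ) - Z) / (2 + 2 * (K : ℝ) - 2 * (K : ℝ) * ((F : ℝ) - Z) / ((F : ℝ) + Z))

/-! ### The arrays `Q`, `Q'` and their stacking -/

/-- The `m`-subsets of `[0,K)`. -/
abbrev Sub (K m : ℕ) : Type := {A : Finset (Fin K) // A.card = m}

/-- The array `Q`: the entry in row `A` and column `k` is `A ∪ {k}` if `k ∉ A`, and a star otherwise. -/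
def subsetArray (K t : ℕ) (A : Sub K t) (k : Fin K) : Option (Sub K (t + 1)) :=
  if h : k ∈ A.1 then none
  else some ⟨insert k A.1, by rw [Finset.card_insert_of_notMem h, A.2]⟩

/-- `D` lists `binom(K-1,t)` parallel classes that partition the `(t+1)`-subsets of `[0,K)`:
each class consists of pairwise disjoint `(t+1)`-subsets with union `[0,K)`, and every `(t+1)`-subset
lies in exactly one class. -/
structure IsParallelClasses (K t : ℕ)
    (D : Fin ((K - 1).choose t) → Finset (Finset (Fin K))) : Prop where
  card_eq : ∀ i, ∀ B ∈ D i, B.card = t + 1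
  disjoint : ∀ i, ∀ B ∈ D i, ∀ B' ∈ D i, B ≠ B' → Disjoint B B'
  cover : ∀ i k, ∃ B ∈ D i, k ∈ B
  partition : ∀ B : Finset (Fin K), B.card = t + 1 → ∃! i, B ∈ D i

open Classical in
/-- The array `Q'`: the entry in row `D i` and column `k` is the block of `D i` that contains `k`. -/
noncomputable def parallelArray (K t : ℕ) (D : Fin ((K - 1).choose t) → Finset (Finset (Fin K)))
    (i : Fin ((K - 1).choose t)) (k : Fin K) : Option (Sub K (t + 1)) :=
  if h : ∃ B : Sub K (t + 1), B.1 ∈ D i ∧ k ∈ B.1 then some h.choose else none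

/-- Row indices of `Q'` stacked over `Q`. -/
abbrev StackRow (K t : ℕ) : Type := Fin ((K - 1).choose t) ⊕ Sub K t

/-- The array `Q'` stacked over `Q`, its rows numbered by `r` and its symbols numbered by `σ`. -/
noncomputable def stackedArray (K t : ℕ) (D : Fin ((K - 1).choose t) → Finset (Finset (Fin K)))
    {F S : ℕ} (r : StackRow K t ≃ Fin F) (σ : Sub K (t + 1) ≃ Fin S) : PArray K F S :=
  fun j k => (Sum.elim (parallelArray K t D) (subsetArray K t) (r.symm j) k).map σ

/-! ### Shannon information of random variables on a finite uniform probability space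

Logarithms are natural; the base only scales all quantities. -/

/-- Probability of an event under the uniform distribution. -/
noncomputable def prob {Ω : Type*} [Fintype Ω] (E : Set Ω) : ℝ :=
  (Nat.card E : ℝ) / (Fintype.card Ω : ℝ)

open Classical in
/-- `H(X)`. -/
noncomputable def entropy {Ω α : Type*} [Fintype Ω] (X : Ω → α) : ℝ :=
  ∑ x ∈ Finset.univ.image X, Real.negMulLog (prob {ω | X ω = x})

/-- `H(X | Y)`. -/
noncomputable def condEntropy {Ω α β : Type*} [Fintype Ω] (X : Ω → α) (Y : Ω → β) : ℝ :=
  entropy (fun ω => (X ω, Y ω)) - entropy Y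

/-- `I(X ; Y)`. -/
noncomputable def mutualInfo {Ω α β : Type*} [Fintype Ω] (X : Ω → α) (Y : Ω → β) : ℝ :=
  entropy X - condEntropy X Y

/-- `I(X ; Y | Z)`. -/
noncomputable def condMutualInfo {Ω α β γ : Type*} [Fintype Ω]
    (X : Ω → α) (Y : Ω → β) (Z : Ω → γ) : ℝ :=
  condEntropy X Z - condEntropy X (fun ω => (Y ω, Z ω))

/-! ### Caching schemes -/

/-- An `F`-division caching scheme for `K` users and `N` files with `S` multicast signals.
Packets are named by pairs `(n,j)`: the `j`-th packet of file `n`. -/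
structure CachingScheme (K N F S : ℕ) where
  /-- the group of users to which the `s`-th signal is sent; its members share the `s`-th key -/
  group : Fin S → Finset (Fin K)
  /-- the packets placed into the cache of a user -/
  placed : Fin K → Finset (Fin N × Fin F)
  /-- the packets whose XOR is the `s`-th signal, for a vector of pairwise different demands -/
  coded : (Fin K ↪ Fin N) → Fin S → Finset (Fin N × Fin F)

/-- Bit strings of length `b`; addition is XOR. -/
abbrev Bits (b : ℕ) : Type := Fin b → ZMod 2

/-- The random data: the files (each of `F` packets of `b` bits), one permutation of the packet indices
per file, one secret key per signal, and the vector of pairwise different demands. Under the uniform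
distribution on this product the four components are independent and uniform. -/
abbrev Sample (K N F S b : ℕ) : Type :=
  (Fin N → Fin F → Bits b) × (Fin N → Equiv.Perm (Fin F)) × (Fin S → Bits b) × (Fin K ↪ Fin N)

namespace Sample

variable {K N F S b : ℕ}

/-- the files `W` -/
def files (ω : Sample K N F S b) : Fin N → Fin F → Bits b := ω.1

/-- the permutations `φ` -/
def perms (ω : Sample K N F S b) : Fin N → Equiv.Perm (Fin F) := ω.2.1

/-- the secret keys `T` -/
def keys (ω : Sample K N F S b) : Fin S → Bits b := ω.2.2.1

/-- the demand vector `d` -/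
def demands (ω : Sample K N F S b) : Fin K ↪ Fin N := ω.2.2.2

end Sample

namespace CachingScheme

variable {K N F S : ℕ} (C : CachingScheme K N F S)

/-- Cache size of user `k` in units of files. -/
noncomputable def cacheSize (k : Fin K) : ℝ := ((C.placed k).card : ℝ) / (F : ℝ)

/-- The transmission rate in units of files: there are `S` signals, each as long as a packet. -/
noncomputable def rate (_C : CachingScheme K N F S) : ℝ := (S : ℝ) / (F : ℝ)

/-- The signals that are sent to user `k`. -/
abbrev SignalOf (k : Fin K) : Type := {s : Fin S // k ∈ C.group s}

variable {b : ℕ}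

/-- The cache `𝒵ₖ` as user `k` sees it. The `j`-th packet of file `n` carries the index `φₙ(j)`, so
the user sees at `(n,i)` the content of the packet of file `n` carrying index `i`, if it is placed. -/
def cacheView (k : Fin K) (ω : Sample K N F S b) : Fin N → Fin F → Option (Bits b) := fun n i =>
  if (n, (ω.perms n).symm i) ∈ C.placed k then some (ω.files n ((ω.perms n).symm i)) else none

/-- The bits in the cache of user `k`, without the indices that the packets carry. -/
def cacheBits (k : Fin K) (ω : Sample K N F S b) : {p // p ∈ C.placed k} → Bits b :=
  fun p => ω.files p.1.1 p.1.2

/-- The keys `𝒯ₖ` of user `k`. -/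
def keyView (k : Fin K) (ω : Sample K N F S b) : C.SignalOf k → Bits b := fun s => ω.keys s.1

/-- The coded signal `X` of the `s`-th group. -/
def signal (s : Fin S) (ω : Sample K N F S b) : Bits b :=
  ∑ p ∈ C.coded ω.demands s, ω.files p.1 p.2

/-- The header of the `s`-th signal: the indices carried by the packets in it. -/
def header (s : Fin S) (ω : Sample K N F S b) : Finset (Fin N × Fin F) :=
  (C.coded ω.demands s).image fun p => (p.1, ω.perms p.1 p.2)

/-- The encrypted signal `T ⊕ X`. -/
def encrypted (s : Fin S) (ω : Sample K N F S b) : Bits b := ω.keys s + C.signal s ω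

/-- `C` is an `F`-division `(K,M,N)` secure coded caching scheme with rate `R`, for packets of `b`
bits and pairwise different demands. -/
structure IsSecure (b : ℕ) (M R : ℝ) : Prop where
  /-- every user stores exactly `M` files -/
  cache : ∀ k, C.cacheSize k = M
  M_pos : 0 < M
  M_lt : M < N
  rate_eq : C.rate = R
  /-- each group gets at most one multicast opportunity -/
  group_injective : Function.Injective C.group
  /-- each user has `F (1 - M/N)` keys -/
  key_count : ∀ k, (Fintype.card (C.SignalOf k) : ℝ) = F * (1 - M / N)
  /-- each user recovers its file from its cache, its keys, the encrypted signals with their headers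
  sent to it, its demand and the permutation of its file -/
  decodable : ∀ k, condEntropy
    (fun ω : Sample K N F S b => ω.files (ω.demands k))
    (fun ω => (C.cacheView k ω, C.keyView k ω,
      (fun s : C.SignalOf k => (C.header s.1 ω, C.encrypted s.1 ω)),
      ω.perms (ω.demands k), ω.demands k)) = 0
  /-- each user learns nothing about the demands of the other users -/
  privacy : ∀ k, condMutualInfo
    (fun ω : Sample K N F S b => fun i : {i : Fin K // i ≠ k} => ω.demands i.1)
    (fun ω => fun s : C.SignalOf k => (C.header s.1 ω, C.signal s.1 ω))
    (fun ω => (ω.perms (ω.demands k), C.cacheView k ω, ω.demands k)) = 0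
  /-- the bits cached and received by a user carry no information about the permutations -/
  perms_hidden : ∀ k, mutualInfo
    (fun ω : Sample K N F S b => ω.perms)
    (fun ω => (C.cacheBits k ω, C.keyView k ω, fun s : C.SignalOf k => C.signal s.1 ω)) = 0
  /-- a wiretapper who sees the whole broadcast learns nothing about the files -/
  wiretap : mutualInfo
    (fun ω : Sample K N F S b => ω.files)
    (fun ω => fun s : Fin S => (C.header s ω, C.encrypted s ω)) = 0

end CachingScheme

/-! ### The scheme realized by an array -/

section OfArray

variable {K F S : ℕ} (P : PArray K F S)

/-- Row `j` contains the symbol `s` at least twice, i.e. `j = j⁽ˢ⁾`. -/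
def IsKeyRow (s : Fin S) (j : Fin F) : Prop :=
  2 ≤ (Finset.univ.filter fun k => P j k = some s).card

instance (s : Fin S) (j : Fin F) : Decidable (IsKeyRow P s j) := by
  unfold IsKeyRow; infer_instance

/-- The columns containing `s`. -/
def columnsOf (s : Fin S) : Finset (Fin K) := Finset.univ.filter fun k => ∃ j, P j k = some s

/-- The scheme realized by the array `P`.
User `k` caches, from every file, the packets `j` with `P j k = *` and those with `P j k = s` and
`j = j⁽ˢ⁾` for some `s`. The `s`-th signal goes to the columns containing `s`; it is the XOR of the
packets `(dₖ, j)` with `P j k = s`, `j ≠ j⁽ˢ⁾`, and of the packets `(n, j⁽ˢ⁾)` of all files `n` not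
demanded in that group. -/
def schemeOf (N : ℕ) : CachingScheme K N F S where
  group := columnsOf P
  placed k := Finset.univ.filter fun p =>
    P p.2 k = none ∨ ∃ s, P p.2 k = some s ∧ IsKeyRow P s p.2
  coded d s := Finset.univ.filter fun p =>
    (∃ k, p.1 = d k ∧ P p.2 k = some s ∧ ¬ IsKeyRow P s p.2) ∨
    ((∀ k ∈ columnsOf P s, p.1 ≠ d k) ∧ IsKeyRow P s p.2)

end OfArray

end SecureCaching

namespace SecureCaching

open Finset

/-! Parallel classes exist by Baranyai's theorem, proved by inserting the points one at a time and
rounding a fractional placement with Hall's theorem (`exists_choice_of_weights`,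
`exists_labelling_of_partMultiplicity`).

In the stacked array the columns of a symbol `B` are the elements of `B`. It fills them in the row
of its parallel class and stands once in each row `B \ {k}`, where the other columns of `B` carry
stars. This is the SPDA pattern, and different symbols have different column sets
(`stackedArray_isSPDA`, `columnsOf_stackedArray`).

Optimality comes from double counting (`IsSPDA.spdaLowerBound_le`). Every diagonal occurrence of a
symbol with `g` columns sees `g - 1` stars in its row, so `∑ g (g - 1)` is bounded by the incidences
of diagonal entries and stars in common rows. Cauchy-Schwarz and a weighted row estimate then bound
`S` below, and the stacked array attains the bound.

Security holds for any SPDA with `Z < F` and pairwise different column sets (`IsSPDA.isSecure`).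
Each signal contains exactly one packet of every file, and a member of its group caches all of these
except the packet of its own file. Changing the demands of the others only moves these packets
inside the cached part, which a permutation of the rows conceals. Independence is obtained by
counting, from injections that exchange the hidden values and fix the view
(`condMutualInfo_eq_zero_of_exchange`). -/

/-! ### Baranyai's theorem -/

/-- Rounding a fractional choice: if every `i` distributes the weight `L` over its options, and the
options of type `c` carry the total weight `L * cap c`, then one option can be chosen for every `i`
such that each type `c` is chosen exactly `cap c` times. -/
theorem exists_choice_of_weights {ι β κ : Type*} [Fintype ι] [Fintype β] [Fintype κ]
    [DecidableEq κ] (typ : ι → β → κ) (w cap : κ → ℕ) {L : ℕ} (hL : 0 < L)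
    (hrow : ∀ i, ∑ p, w (typ i p) = L)
    (hcol : ∀ c, w c * #{q : ι × β | typ q.1 q.2 = c} = L * cap c) :
    ∃ p : ι → β, ∀ c, #{i | typ i (p i) = c} = cap c := by
  classical
  -- Each type `c` is split into `cap c` slots, to be matched injectively with the indices `i`.
  -- Hall's condition holds because the rows in `X` carry weight `L * #X`, all of it on types
  -- reachable from `X`.
  let t : ι → Finset (Σ c, Fin (cap c)) := fun i => {s | ∃ p, typ i p = s.1}
  have hall : ∀ X : Finset ι, #X ≤ #(X.biUnion t) := by
    intro X
    set V : Finset κ := {c | ∃ i ∈ X, ∃ p, typ i p = c} with hV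
    have hunion : X.biUnion t = V.sigma fun _ => univ := by
      ext ⟨c, j⟩
      simp [t, hV]
    have hcard : #(X.biUnion t) = ∑ c ∈ V, cap c := by
      rw [hunion, card_sigma]
      simp
    refine Nat.le_of_mul_le_mul_left ?_ hL
    calc L * #X = ∑ i ∈ X, ∑ p, w (typ i p) := by
          rw [sum_congr rfl fun i _ => hrow i, sum_const, smul_eq_mul, mul_comm]
      _ = ∑ q ∈ X ×ˢ (univ : Finset β), w (typ q.1 q.2) := by rw [sum_product]
      _ = ∑ c ∈ V, ∑ q ∈ X ×ˢ (univ : Finset β) with typ q.1 q.2 = c, w (typ q.1 q.2) := by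
          refine (sum_fiberwise_of_maps_to ?_ _).symm
          rintro ⟨i, p⟩ h
          simp only [mem_product, mem_univ, and_true] at h
          simp only [hV, mem_filter, mem_univ, true_and]
          exact ⟨i, h, p, rfl⟩
      _ = ∑ c ∈ V, w c * #{q ∈ X ×ˢ (univ : Finset β) | typ q.1 q.2 = c} := by
          refine sum_congr rfl fun c _ => ?_
          rw [sum_congr rfl (g := fun _ => w c) fun q hq => by rw [(mem_filter.1 hq).2],
            sum_const, smul_eq_mul, mul_comm]
      _ ≤ ∑ c ∈ V, w c * #{q : ι × β | typ q.1 q.2 = c} := by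
          gcongr
          exact subset_univ _
      _ = L * #(X.biUnion t) := by
          rw [hcard, mul_sum]
          exact sum_congr rfl fun c _ => hcol c
  obtain ⟨g, hg, hgt⟩ := (all_card_le_biUnion_card_iff_exists_injective t).1 hall
  have hp : ∀ i, ∃ p, typ i p = (g i).1 := fun i => by simpa [t] using hgt i
  choose p hp using hp
  refine ⟨p, ?_⟩
  have hle : ∀ c, #{i | typ i (p i) = c} ≤ cap c := by
    intro c
    calc #{i | typ i (p i) = c} ≤ #(({c} : Finset κ).sigma fun c => (univ : Finset (Fin (cap c)))) := by
          refine card_le_card_of_injOn g ?_ hg.injOn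
          intro i hi
          simp only [coe_filter, mem_univ, true_and, Set.mem_ofPred_eq] at hi
          simp [← hp, hi]
      _ = cap c := by rw [card_sigma]; simp
  -- The matching only gives `≤` for each type; comparing total weights shows that all slots are
  -- used.
  have hsum : ∑ c, #{i | typ i (p i) = c} = ∑ c, cap c := by
    refine Nat.eq_of_mul_eq_mul_left hL ?_
    calc L * ∑ c, #{i | typ i (p i) = c} = ∑ i : ι, ∑ p, w (typ i p) := by
          rw [← card_eq_sum_card_fiberwise (s := univ) (t := univ) (fun _ _ => mem_univ _),
            sum_congr rfl fun i _ => hrow i, sum_const, smul_eq_mul, mul_comm]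
      _ = ∑ q : ι × β, w (typ q.1 q.2) := by rw [Fintype.sum_prod_type]
      _ = ∑ c, ∑ q : ι × β with typ q.1 q.2 = c, w (typ q.1 q.2) :=
          (sum_fiberwise _ _ _).symm
      _ = ∑ c, w c * #{q : ι × β | typ q.1 q.2 = c} := by
          refine sum_congr rfl fun c _ => ?_
          rw [sum_congr rfl (g := fun _ => w c) fun q hq => by rw [(mem_filter.1 hq).2],
            sum_const, smul_eq_mul, mul_comm]
      _ = L * ∑ c, cap c := by
          rw [mul_sum]
          exact sum_congr rfl fun c _ => hcol c
  intro c
  exact (sum_eq_sum_iff_of_le fun c _ => hle c).1 hsum c (mem_univ c)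

/-- The multiplicity in Baranyai's induction: how often the set `S` has to occur among the parts of
`U` so that the parts extend to every `k`-subset of an `n`-set exactly once. -/
def partMultiplicity {α : Type*} [DecidableEq α] (n k : ℕ) (U S : Finset α) : ℕ :=
  if S ⊆ U ∧ #S ≤ k then (n - #U).choose (k - #S) else 0

/-- `f i` cuts `U` into `m` parts, some possibly empty, the trace on `U` of a future parallel class.
A new point `a` is added to one part in each of the `M` partitions, and rounding chooses the parts
so that the multiplicities stay as prescribed. -/
theorem exists_labelling_of_partMultiplicity {α : Type*} [Fintype α] [DecidableEq α]
    {n k m M : ℕ} (hm : 0 < m) (hn : n = m * k) (hM : M * m = n.choose k) (U : Finset α)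
    (hU : #U ≤ n) :
    ∃ f : Fin M → α → Fin m, ∀ S : Finset α,
      #{q : Fin M × Fin m | ({x ∈ U | f q.1 x = q.2} : Finset α) = S} =
        partMultiplicity n k U S := by
  induction U using Finset.induction_on with
  | empty =>
    refine ⟨fun _ _ => ⟨0, hm⟩, fun S => ?_⟩
    by_cases hS : S = ∅
    · simp [hS, partMultiplicity, hM]
    · simp [partMultiplicity, hS, Ne.symm hS]
  | insert a U ha ih =>
    rw [card_insert_of_notMem ha] at hU
    obtain ⟨f, hf⟩ := ih (by omega)
    set typ : Fin M → Fin m → Finset α := fun i p => {x ∈ U | f i x = p} with htyp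
    have hf' : ∀ S, #{q : Fin M × Fin m | typ q.1 q.2 = S} = partMultiplicity n k U S := hf
    have hsub : ∀ i p, typ i p ⊆ U := fun i p => filter_subset _ _
    have hle : ∀ i p, #(typ i p) ≤ k := by
      intro i p
      by_contra h
      have h0 := hf' (typ i p)
      rw [partMultiplicity, if_neg (fun h' => h h'.2), card_eq_zero] at h0
      exact notMem_empty (i, p) (h0 ▸ mem_filter.2 ⟨mem_univ _, rfl⟩)
    -- A part `S` lacks `k - #S` points, so it should receive `a` with probability `(k - #S) / (n -
    -- #U)`. The expected number of copies of `S` receiving `a` is the integer `cap S`, by `x *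
    -- (x-1).choose (y-1) = y * x.choose y`.
    set cap : Finset α → ℕ := fun S =>
      if S ⊆ U ∧ #S < k then (n - #U - 1).choose (k - #S - 1) else 0 with hcap
    obtain ⟨p, hp⟩ := exists_choice_of_weights typ (fun S => k - #S) cap (L := n - #U)
      (by omega) (by
        intro i
        have h1 : ∑ q, #(typ i q) = #U :=
          (card_eq_sum_card_fiberwise (f := f i) (t := univ) (fun _ _ => mem_univ _)).symm
        have h2 : ∑ q, (k - #(typ i q)) + ∑ q, #(typ i q) = m * k := by
          rw [← sum_add_distrib, sum_congr rfl fun q _ => Nat.sub_add_cancel (hle i q)]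
          simp
        omega) (by
        intro S
        rw [hf', partMultiplicity, hcap]
        by_cases hS : S ⊆ U ∧ #S < k
        · rw [if_pos ⟨hS.1, hS.2.le⟩]
          simp only [if_pos hS]
          obtain ⟨x, hx⟩ : ∃ x, n - #U = x + 1 := ⟨n - #U - 1, by omega⟩
          obtain ⟨y, hy⟩ : ∃ y, k - #S = y + 1 := ⟨k - #S - 1, by omega⟩
          rw [hx, hy, Nat.add_sub_cancel, Nat.add_sub_cancel, Nat.add_one_mul_choose_eq, mul_comm]
        · simp only [if_neg hS, mul_zero, mul_eq_zero]
          by_cases h : S ⊆ U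
          · left
            have : ¬ #S < k := fun h' => hS ⟨h, h'⟩
            omega
          · right
            rw [if_neg fun h' => h h'.1])
    refine ⟨fun i => Function.update (f i) a (p i), fun S => ?_⟩
    have hfib : ∀ i q, ({x ∈ insert a U | Function.update (f i) a (p i) x = q} : Finset α) =
        if p i = q then insert a (typ i q) else typ i q := by
      intro i q
      rw [filter_insert, Function.update_self, filter_congr (s := U) (q := fun x => f i x = q)]
      intro x hx
      rw [Function.update_of_ne (ne_of_mem_of_not_mem hx ha)]
    simp only [hfib]
    by_cases haS : a ∈ S
    · have hcount : #{q : Fin M × Fin m |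
          (if p q.1 = q.2 then insert a (typ q.1 q.2) else typ q.1 q.2) = S} =
          #{i | typ i (p i) = S.erase a} := by
        refine card_bij' (fun q _ => q.1) (fun i _ => (i, p i)) ?_ ?_ ?_ ?_
        · rintro ⟨i, q⟩ h
          simp only [mem_filter, mem_univ, true_and] at h ⊢
          split_ifs at h with hq
          · rw [← h, erase_insert fun h' => ha (hsub _ _ h'), hq]
          · exact absurd (h ▸ haS) fun h' => ha (hsub _ _ h')
        · intro i h
          simp only [mem_filter, mem_univ, true_and, if_true] at h ⊢
          rw [h, insert_erase haS]
        · rintro ⟨i, q⟩ h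
          simp only [mem_filter, mem_univ, true_and] at h ⊢
          split_ifs at h with hq
          · rw [hq]
          · exact absurd (h ▸ haS) fun h' => ha (hsub _ _ h')
        · intro i _
          rfl
      rw [hcount, hp, partMultiplicity, card_insert_of_notMem ha]
      have hpos : 0 < #S := card_pos.2 ⟨a, haS⟩
      have hiff : (S.erase a ⊆ U ∧ #S - 1 < k) ↔ (S ⊆ insert a U ∧ #S ≤ k) := by
        rw [subset_insert_iff]
        constructor <;> rintro ⟨h, h'⟩ <;> exact ⟨h, by omega⟩
      simp only [hcap, card_erase_of_mem haS, hiff]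
      congr 2; omega
    -- The copies of `S` that survive are the old ones minus those that received `a`; the new
    -- multiplicity then follows from Pascal's rule.
    · have hcount : #{q : Fin M × Fin m |
          (if p q.1 = q.2 then insert a (typ q.1 q.2) else typ q.1 q.2) = S} +
          #{i | typ i (p i) = S} = #{q : Fin M × Fin m | typ q.1 q.2 = S} := by
        have himg : #{i | typ i (p i) = S} =
            #{q : Fin M × Fin m | typ q.1 q.2 = S ∧ p q.1 = q.2} := by
          refine card_bij' (fun i _ => (i, p i)) (fun q _ => q.1) ?_ ?_ ?_ ?_
          · intro i h
            simpa using h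
          · rintro ⟨i, q⟩ h
            simp only [mem_filter, mem_univ, true_and] at h ⊢
            rw [h.2, h.1]
          · intro i _
            rfl
          · rintro ⟨i, q⟩ h
            simp only [mem_filter, mem_univ, true_and] at h ⊢
            rw [h.2]
        rw [himg, ← card_union_of_disjoint]
        · congr 1
          ext ⟨i, q⟩
          simp only [mem_union, mem_filter, mem_univ, true_and]
          by_cases hq : p i = q
          · simp only [hq, if_true, and_true]
            constructor
            · rintro (h | h)
              · exact absurd (h ▸ mem_insert_self _ _) haS
              · exact h
            · exact Or.inr
          · simp [hq]
        · rw [disjoint_left]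
          rintro ⟨i, q⟩ h h'
          simp only [mem_filter, mem_univ, true_and] at h h'
          rw [if_pos h'.2] at h
          exact haS (h ▸ mem_insert_self _ _)
      rw [hp, hf', hcap] at hcount
      rw [partMultiplicity] at hcount ⊢
      simp only [subset_insert_iff_of_notMem haS, card_insert_of_notMem ha]
      by_cases hSU : S ⊆ U
      · rcases lt_trichotomy (#S) k with h | h | h
        · simp only [hSU, h, h.le, and_self, if_true] at hcount ⊢
          obtain ⟨x, hx⟩ : ∃ x, n - #U = x + 1 := ⟨n - #U - 1, by omega⟩
          obtain ⟨y, hy⟩ : ∃ y, k - #S = y + 1 := ⟨k - #S - 1, by omega⟩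
          rw [hx, hy, Nat.choose_succ_succ'] at hcount
          rw [show n - (#U + 1) = x by omega, hy]
          simp only [Nat.add_sub_cancel] at hcount
          omega
        · simpa [hSU, h] using hcount
        · simpa [hSU, h, h.not_gt, h.le.not_gt, h.not_ge] using hcount
      · simpa [hSU] using hcount

/-- **Baranyai's theorem**: if `t + 1` divides `K`, the `(t + 1)`-subsets of `[0,K)` can be
partitioned into parallel classes. -/
theorem exists_isParallelClasses {K t : ℕ} (hK : 0 < K) (hdiv : (t + 1) ∣ K) :
    ∃ D, IsParallelClasses K t D := by
  obtain ⟨m, hm⟩ := hdiv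
  have hm0 : 0 < m := Nat.pos_of_ne_zero (by rintro rfl; omega)
  have hM : (K - 1).choose t * m = K.choose (t + 1) := by
    obtain ⟨x, rfl⟩ : ∃ x, K = x + 1 := ⟨K - 1, by omega⟩
    have h := Nat.add_one_mul_choose_eq x t
    refine Nat.eq_of_mul_eq_mul_left (Nat.succ_pos t) ?_
    rw [Nat.add_sub_cancel, Nat.succ_eq_add_one, mul_comm (t + 1) ((x + 1).choose (t + 1)), ← h, hm]
    ring
  obtain ⟨f, hf⟩ := exists_labelling_of_partMultiplicity hm0 (hm.trans (mul_comm _ _)) hM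
    (univ : Finset (Fin K)) (by simp)
  -- Once all points are placed, the multiplicity is `(0).choose (t + 1 - #S)`, which is `1` exactly
  -- for the `(t + 1)`-sets.
  have hf' : ∀ S : Finset (Fin K), #{q : Fin ((K - 1).choose t) × Fin m |
      ({x | f q.1 x = q.2} : Finset (Fin K)) = S} = if #S = t + 1 then 1 else 0 := by
    intro S
    rw [hf S, partMultiplicity]
    simp only [subset_univ, true_and, card_univ, Fintype.card_fin, Nat.sub_self]
    rcases lt_trichotomy (#S) (t + 1) with h | h | h
    · rw [if_pos h.le, if_neg h.ne, Nat.choose_eq_zero_of_lt (by omega)]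
    · simp [h]
    · rw [if_neg h.not_ge, if_neg h.ne']
  have hcard : ∀ i q, #({x | f i x = q} : Finset (Fin K)) = t + 1 := by
    intro i q
    by_contra h
    have h0 := hf' {x | f i x = q}
    rw [if_neg h, card_eq_zero] at h0
    exact notMem_empty (i, q) (h0 ▸ mem_filter.2 ⟨mem_univ _, rfl⟩)
  refine ⟨fun i => univ.image fun q => ({x | f i x = q} : Finset (Fin K)), ?_, ?_, ?_, ?_⟩
  · intro i B hB
    obtain ⟨q, -, rfl⟩ := mem_image.1 hB
    exact hcard i q
  · intro i B hB B' hB' hne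
    obtain ⟨q, -, rfl⟩ := mem_image.1 hB
    obtain ⟨q', -, rfl⟩ := mem_image.1 hB'
    rw [disjoint_left]
    intro x hx hx'
    simp only [mem_filter, mem_univ, true_and] at hx hx'
    exact hne (by rw [← hx, ← hx'])
  · intro i k
    exact ⟨_, mem_image_of_mem _ (mem_univ (f i k)), by simp⟩
  · intro B hB
    have h1 := hf' B
    rw [if_pos hB, card_eq_one] at h1
    obtain ⟨⟨i, q⟩, h1⟩ := h1
    have hmem : ∀ i' q', ({x | f i' x = q'} : Finset (Fin K)) = B ↔ (i', q') = (i, q) := by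
      intro i' q'
      have h2 : (i', q') ∈ ({(i, q)} : Finset _) ↔ _ := mem_singleton
      rw [← h2, ← h1]
      simp
    refine ⟨i, mem_image.2 ⟨q, mem_univ _, (hmem i q).2 rfl⟩, ?_⟩
    intro i' hi'
    obtain ⟨q', -, h'⟩ := mem_image.1 hi'
    exact congrArg Prod.fst ((hmem i' q').1 h')

/-! ### The rows of a symbol in a secure placement delivery array -/

section RowSystem

variable {K F Z S : ℕ} {P : PArray K F S} {J : Fin S → Fin F} {R : Fin S → Fin K → Fin F}

/-- `J s` is the row that contains `s` repeatedly, and `R s k` is the other row with `s` in column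
`k`, for the columns `k` that contain `s`. -/
structure IsRowSystem (P : PArray K F S) (J : Fin S → Fin F) (R : Fin S → Fin K → Fin F) :
    Prop where
  isKeyRow_iff : ∀ s j, IsKeyRow P s j ↔ j = J s
  eq_some_iff : ∀ s j k, P j k = some s ↔ k ∈ columnsOf P s ∧ (j = J s ∨ j = R s k)
  ne_key : ∀ s, ∀ k ∈ columnsOf P s, R s k ≠ J s
  star : ∀ s, ∀ k ∈ columnsOf P s, ∀ k' ∈ columnsOf P s, k ≠ k' → P (R s k) k' = none

/-- This replaces the enumerated subarrays of (C3) by functions on symbols and columns, the form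
used by both the counting and the security arguments. -/
theorem IsSPDA.exists_isRowSystem (h : IsSPDA K F Z S P) : ∃ J R, IsRowSystem P J R := by
  have key : ∀ s, ∃ (j₀ : Fin F) (ρ : Fin K → Fin F), (∀ j, IsKeyRow P s j ↔ j = j₀) ∧
      (∀ j k, P j k = some s ↔ k ∈ columnsOf P s ∧ (j = j₀ ∨ j = ρ k)) ∧
      (∀ k ∈ columnsOf P s, ρ k ≠ j₀) ∧
      ∀ k ∈ columnsOf P s, ∀ k' ∈ columnsOf P s, k ≠ k' → P (ρ k) k' = none := by
    intro s
    obtain ⟨g, j₀, r, c, hr, hc, hj₀, hrows, hcols, hkey, hdiag, hoff⟩ := h.subarray s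
    have hmem : ∀ k, k ∈ columnsOf P s ↔ ∃ i, c i = k := by
      intro k
      have := Set.ext_iff.1 hcols k
      simpa [columnsOf] using this
    have hρ : ∀ i, Function.extend c r (fun _ => j₀) (c i) = r i := fun i => hc.extend_apply _ _ i
    have hiff : ∀ j i, P j (c i) = some s ↔ j = j₀ ∨ j = r i := by
      intro j i
      constructor
      · intro hj
        have : j ∈ insert j₀ (Set.range r) := hrows ▸ ⟨c i, hj⟩
        rcases this with rfl | ⟨l, rfl⟩
        · exact Or.inl rfl
        · by_cases hl : l = i
          · exact Or.inr (by rw [hl])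
          · simp [hoff l i hl] at hj
      · rintro (rfl | rfl)
        · exact hkey i
        · exact hdiag i
    have hsome : ∀ j k, P j k = some s → ∃ i, c i = k := fun j k hj =>
      (hmem k).1 (mem_filter.2 ⟨mem_univ _, j, hj⟩)
    -- The symbol occurs at most `2 * g` times, so (C2) forces two columns; without this the
    -- constant row would not be a key row.
    have hg : 2 ≤ g := by
      have hsub : (univ.filter fun p : Fin F × Fin K => P p.1 p.2 = some s) ⊆
          (univ.image fun i => (j₀, c i)) ∪ univ.image fun i => (r i, c i) := by
        rintro ⟨j, k⟩ hp
        have hp := (mem_filter.1 hp).2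
        obtain ⟨i, rfl⟩ := hsome j k hp
        rcases (hiff j i).1 hp with rfl | rfl
        · exact mem_union_left _ (mem_image_of_mem _ (mem_univ i))
        · exact mem_union_right _ (mem_image_of_mem (fun i => (r i, c i)) (mem_univ i))
      have h4 := (h.four_le s).trans ((card_le_card hsub).trans (card_union_le _ _))
      have h1 := card_image_le (s := (univ : Finset (Fin g))) (f := fun i => (j₀, c i))
      have h2 := card_image_le (s := (univ : Finset (Fin g))) (f := fun i => (r i, c i))
      rw [card_univ, Fintype.card_fin] at h1 h2
      omega
    refine ⟨j₀, Function.extend c r fun _ => j₀, ?_, ?_, ?_, ?_⟩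
    · intro j
      constructor
      · intro hj
        obtain ⟨k, hk, k', hk', hne⟩ := one_lt_card.1 hj
        have hk := (mem_filter.1 hk).2
        have hk' := (mem_filter.1 hk').2
        obtain ⟨i, rfl⟩ := hsome j k hk
        obtain ⟨i', rfl⟩ := hsome j k' hk'
        rcases (hiff j i).1 hk with h1 | h1
        · exact h1
        rcases (hiff j i').1 hk' with h2 | h2
        · exact h2
        exact absurd (congrArg c (hr (h1.symm.trans h2))) hne
      · rintro rfl
        calc 2 ≤ #(univ.image c) := by rwa [card_image_of_injective _ hc, card_univ, Fintype.card_fin]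
          _ ≤ _ := card_le_card fun k hk => by
            obtain ⟨i, -, rfl⟩ := mem_image.1 hk
            exact mem_filter.2 ⟨mem_univ _, hkey i⟩
    · intro j k
      constructor
      · intro hj
        obtain ⟨i, rfl⟩ := hsome j k hj
        rw [hρ]
        exact ⟨(hmem _).2 ⟨i, rfl⟩, (hiff j i).1 hj⟩
      · rintro ⟨hk, hj⟩
        obtain ⟨i, rfl⟩ := (hmem k).1 hk
        rw [hρ] at hj
        exact (hiff j i).2 hj
    · intro k hk
      obtain ⟨i, rfl⟩ := (hmem k).1 hk
      rw [hρ]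
      exact fun h' => hj₀ ⟨i, h'⟩
    · intro k hk k' hk' hne
      obtain ⟨i, rfl⟩ := (hmem k).1 hk
      obtain ⟨i', rfl⟩ := (hmem k').1 hk'
      rw [hρ]
      exact hoff i i' fun h' => hne (congrArg c h')
  choose J R h1 h2 h3 h4 using key
  exact ⟨J, R, h1, h2, h3, h4⟩

namespace IsRowSystem

theorem key_eq (hR : IsRowSystem P J R) {s : Fin S} {k : Fin K} (hk : k ∈ columnsOf P s) :
    P (J s) k = some s := (hR.eq_some_iff s _ k).2 ⟨hk, Or.inl rfl⟩

theorem row_eq (hR : IsRowSystem P J R) {s : Fin S} {k : Fin K} (hk : k ∈ columnsOf P s) :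
    P (R s k) k = some s := (hR.eq_some_iff s _ k).2 ⟨hk, Or.inr rfl⟩

theorem card_rows_eq (hR : IsRowSystem P J R) (s : Fin S) (k : Fin K) :
    #{j | P j k = some s} = if k ∈ columnsOf P s then 2 else 0 := by
  split_ifs with hk
  · rw [show ({j | P j k = some s} : Finset (Fin F)) = {J s, R s k} by
      ext j; simp [hR.eq_some_iff, hk], card_pair (hR.ne_key s k hk).symm]
  · simp [hR.eq_some_iff, hk]

/-- A symbol present in a column occurs there twice, in its key row and in its diagonal row. -/
theorem card_rows (hP : IsSPDA K F Z S P) (hR : IsRowSystem P J R) (k : Fin K) :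
    F = Z + 2 * #{s | k ∈ columnsOf P s} := by
  have h := card_eq_sum_card_fiberwise (s := (univ : Finset (Fin F))) (t := univ)
    (f := fun j => P j k) (fun _ _ => mem_univ _)
  rw [card_univ, Fintype.card_fin, Fintype.sum_option, hP.stars k,
    sum_congr rfl fun s _ => hR.card_rows_eq s k, ← sum_filter, sum_const, smul_eq_mul,
    mul_comm] at h
  exact h

/-- Besides the stars, the cache holds one key row per symbol of the column, and different symbols
of one column have different key rows. -/
theorem card_cached_rows (hP : IsSPDA K F Z S P) (hR : IsRowSystem P J R) (k : Fin K) :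
    #{j | P j k = none ∨ ∃ s, P j k = some s ∧ IsKeyRow P s j} =
      Z + #{s | k ∈ columnsOf P s} := by
  have hkey : #{j | ∃ s, P j k = some s ∧ IsKeyRow P s j} = #{s | k ∈ columnsOf P s} := by
    refine (card_bij (fun s _ => J s) ?_ ?_ ?_).symm
    · intro s hs
      have hs := (mem_filter.1 hs).2
      exact mem_filter.2 ⟨mem_univ _, s, hR.key_eq hs, (hR.isKeyRow_iff s _).2 rfl⟩
    · intro s hs s' hs' hJ
      have h1 := hR.key_eq (mem_filter.1 hs).2
      rw [hJ, hR.key_eq (mem_filter.1 hs').2] at h1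
      exact (Option.some_injective _ h1).symm
    · intro j hj
      obtain ⟨s, hs, hkey⟩ := (mem_filter.1 hj).2
      exact ⟨s, mem_filter.2 ⟨mem_univ _, ((hR.eq_some_iff s j k).1 hs).1⟩,
        ((hR.isKeyRow_iff s j).1 hkey).symm⟩
  rw [filter_or, card_union_of_disjoint, hP.stars k, hkey]
  rw [disjoint_left]
  intro j h1 h2
  obtain ⟨s, hs, -⟩ := (mem_filter.1 h2).2
  rw [(mem_filter.1 h1).2] at hs
  exact absurd hs (by simp)

end IsRowSystem

/-! ### The lower bound on the number of symbols -/

/-- The numerical end of the lower bound: after division by `A`, the hypotheses give `A ≤ S * (1 +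
2KZ / (F + Z))`, where `2A = K(F - Z)`. -/
theorem spdaLowerBound_le_of_sum_sq {K F Z S : ℕ} {A W : ℝ} (hF0 : 0 < F) (hA0 : 0 ≤ A)
    (htotal : 2 * A + K * Z = K * F) (h1 : A ^ 2 ≤ S * (A + W))
    (hW : W * (F + Z) ≤ 2 * K * A * Z) : spdaLowerBound K F Z ≤ S := by
  have hF : (0 : ℝ) < F := by exact_mod_cast hF0
  have hZ : (0 : ℝ) ≤ Z := Nat.cast_nonneg _
  have hmain : A * (F + Z) ≤ S * (F + Z + 2 * K * Z) := by
    rcases hA0.eq_or_lt with h0 | h0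
    · rw [← h0]
      simp only [zero_mul]
      positivity
    · refine le_of_mul_le_mul_left ?_ h0
      have h2 : A ^ 2 * (F + Z) ≤ S * (A + W) * (F + Z) := by gcongr
      have h3 : (S : ℝ) * (W * (F + Z)) ≤ S * (2 * K * A * Z) := by gcongr
      nlinarith
  have hFZ : (0 : ℝ) < F + Z := by linarith
  have hden : 2 + 2 * (K : ℝ) - 2 * K * (F - Z) / (F + Z) = 2 * (F + Z + 2 * K * Z) / (F + Z) := by
    field_simp
    ring
  rw [spdaLowerBound, hden, div_le_iff₀ (by positivity)]
  rw [← mul_div_assoc, le_div_iff₀ hFZ]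
  have : (K : ℝ) * (F - Z) = 2 * A := by linarith
  rw [this]
  linarith

/-- The number of symbols of a secure placement delivery array is at least `spdaLowerBound`. -/
theorem IsSPDA.spdaLowerBound_le (hP : IsSPDA K F Z S P) : spdaLowerBound K F Z ≤ S := by
  obtain ⟨J, R, hR⟩ := hP.exists_isRowSystem
  -- `T` indexes the diagonal entries, one for each symbol and column containing it. Row `j` has `z
  -- j` stars and `a j` diagonal entries, and symbol `s` has `g s` columns.
  let T : Finset (Σ _ : Fin S, Fin K) := univ.sigma (columnsOf P)
  let z : Fin F → ℕ := fun j => #{k | P j k = none}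
  let a : Fin F → ℕ := fun j => #{q ∈ T | R q.1 q.2 = j}
  let g : Fin S → ℕ := fun s => #(columnsOf P s)
  have hT : ∀ q, q ∈ T ↔ q.2 ∈ columnsOf P q.1 := fun q => by simp [T]
  have hstars : ∑ j, z j = K * Z := by
    simp only [z, card_filter]
    rw [sum_comm]
    simp only [← card_filter, hP.stars]
    simp
  have hag : ∑ j, a j = ∑ s, g s := by
    rw [← card_eq_sum_card_fiberwise (s := T) (t := univ) (fun _ _ => mem_univ _), card_sigma]
  have htotal : 2 * ∑ s, g s + K * Z = K * F := by
    have h1 : ∑ s, g s = ∑ k : Fin K, #{s | k ∈ columnsOf P s} := by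
      simp only [card_filter]
      rw [sum_comm]
      simp [g]
    have h2 : ∑ k : Fin K, (Z + 2 * #{s | k ∈ columnsOf P s}) = K * F := by
      rw [sum_congr rfl fun k _ => (hR.card_rows hP k).symm]
      simp
    rw [sum_add_distrib, ← mul_sum, ← h1] at h2
    simp only [sum_const, card_univ, Fintype.card_fin, smul_eq_mul] at h2
    omega
  have haz : ∀ j, a j + z j ≤ K := by
    intro j
    have h1 : a j ≤ #{k | ¬ P j k = none} := by
      refine card_le_card_of_injOn (fun q => q.2) ?_ ?_
      · intro q hq
        obtain ⟨hq', hj⟩ := mem_filter.1 hq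
        simp [← hj, hR.row_eq ((hT q).1 hq')]
      · rintro ⟨s, k⟩ hq ⟨s', k'⟩ hq' hk
        obtain ⟨hq, hj⟩ := mem_filter.1 hq
        obtain ⟨hq', hj'⟩ := mem_filter.1 hq'
        simp only at hk hj hj'
        subst hk
        have h1 := hR.row_eq ((hT _).1 hq)
        have h2 := hR.row_eq ((hT _).1 hq')
        simp only [hj, hj'] at h1 h2
        rw [h1] at h2
        rw [Option.some_injective _ h2]
    have h2 := card_filter_add_card_filter_not (s := (univ : Finset (Fin K)))
      (fun k => P j k = none)
    rw [card_univ, Fintype.card_fin] at h2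
    simp only [z]
    omega
  -- The row of the diagonal entry `(s, k)` has a star in each of the other `g s - 1` columns of
  -- `s`.
  have hgaz : ∑ s, g s * (g s - 1) ≤ ∑ j, a j * z j := by
    calc ∑ s, g s * (g s - 1) = ∑ q ∈ T, (g q.1 - 1) := by
          rw [sum_sigma]
          simp [g]
      _ ≤ ∑ q ∈ T, z (R q.1 q.2) := by
          refine sum_le_sum fun q hq => ?_
          rw [hT] at hq
          rw [← card_erase_of_mem hq]
          refine card_le_card fun k' hk' => mem_filter.2 ⟨mem_univ _, ?_⟩
          exact hR.star _ _ hq _ (mem_of_mem_erase hk') (ne_of_mem_erase hk').symm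
      _ = ∑ j, ∑ q ∈ T with R q.1 q.2 = j, z (R q.1 q.2) := (sum_fiberwise _ _ _).symm
      _ = ∑ j, a j * z j := by
          refine sum_congr rfl fun j _ => ?_
          rw [sum_congr rfl (g := fun _ => z j) fun q hq => by rw [(mem_filter.1 hq).2],
            sum_const, smul_eq_mul]
  have hZF : (Z : ℝ) ≤ F := by
    exact_mod_cast (hR.card_rows hP ⟨0, hP.pos_K⟩) ▸ Nat.le_add_right _ _
  have hF : (0 : ℝ) < F := by exact_mod_cast hP.pos_F
  have hZ : (0 : ℝ) ≤ Z := Nat.cast_nonneg _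
  set A : ℝ := ∑ s, (g s : ℝ) with hA
  set W : ℝ := ∑ j, (a j : ℝ) * z j with hW
  have htotal' : 2 * A + K * Z = K * F := by rw [hA]; exact_mod_cast htotal
  have hag' : ∑ j, (a j : ℝ) = A := by rw [hA]; exact_mod_cast hag
  have hstars' : ∑ j, (z j : ℝ) = K * Z := by exact_mod_cast hstars
  have hcs : A ^ 2 ≤ S * ∑ s, (g s : ℝ) ^ 2 := by
    simpa using sq_sum_le_card_mul_sum_sq (s := (univ : Finset (Fin S))) (f := fun s => (g s : ℝ))
  have hsq : ∑ s, (g s : ℝ) ^ 2 ≤ A + W := by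
    have h1 : (∑ s, (g s * (g s - 1) : ℕ) : ℝ) ≤ W := by rw [hW]; exact_mod_cast hgaz
    have h2 : ∀ s, (g s : ℝ) ^ 2 = g s + (g s * (g s - 1) : ℕ) := by
      intro s
      rcases Nat.eq_zero_or_pos (g s) with h | h
      · simp [h]
      · push_cast [Nat.cast_sub (Nat.succ_le_of_lt h)]
        ring
    rw [sum_congr rfl fun s _ => h2 s, sum_add_distrib]
    linarith
  have hW' : W * (F + Z) ≤ 2 * K * A * Z := by
    -- With `a + z ≤ K` this follows from `(a + z)(4Z²a + (F-Z)²z) = (2Za - (F-Z)z)² + az(F+Z)²`.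
    -- The weights make it tight when `a + z = K` and `a : z = (F-Z) : 2Z`, as in the rows of `Q`,
    -- and when `a = z = 0`, as in the rows of `Q'`.
    have hj : ∀ j, (a j : ℝ) * z j * ((F : ℝ) + Z) ^ 2 ≤
        K * (4 * Z ^ 2 * a j + (F - Z) ^ 2 * z j) := by
      intro j
      have h1 : (a j : ℝ) + z j ≤ K := by exact_mod_cast haz j
      have h2 : (0 : ℝ) ≤ 4 * Z ^ 2 * a j + (F - Z) ^ 2 * z j := by positivity
      have h3 := mul_le_mul_of_nonneg_right h1 h2
      nlinarith [sq_nonneg (2 * (Z : ℝ) * a j - (F - Z) * z j)]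
    have hsum := sum_le_sum fun j (_ : j ∈ univ) => hj j
    rw [← sum_mul, ← mul_sum, sum_add_distrib, ← mul_sum, ← mul_sum, hag', hstars'] at hsum
    refine le_of_mul_le_mul_right ?_ (show (0 : ℝ) < F + Z by linarith)
    have e : (K : ℝ) * (4 * Z ^ 2 * A + (F - Z) ^ 2 * (K * Z)) = 2 * K * A * Z * (F + Z) := by
      have : (F - Z : ℝ) * K = 2 * A := by linarith
      linear_combination (K * Z * (F - Z)) * this
    rw [← e]
    calc W * (F + Z) * (F + Z) = W * (F + Z) ^ 2 := by ring
      _ ≤ _ := hsum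
  have h1 : A ^ 2 ≤ S * (A + W) := hcs.trans (mul_le_mul_of_nonneg_left hsq (Nat.cast_nonneg _))
  exact spdaLowerBound_le_of_sum_sq hP.pos_F (sum_nonneg fun _ _ => Nat.cast_nonneg _)
    htotal' h1 hW'

end RowSystem

/-! ### Vanishing of conditional entropy and mutual information -/

section Information

variable {Ω α β γ : Type*} [Fintype Ω]

open Classical in
/-- The number of sample points at which `X` takes the same value as at `ω`. -/
noncomputable def fiberCard (X : Ω → α) (ω : Ω) : ℕ := #{ω' | X ω' = X ω}

theorem fiberCard_pos (X : Ω → α) (ω : Ω) : 0 < fiberCard X ω := by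
  classical
  exact card_pos.2 ⟨ω, by simp⟩

/-- Writing entropy as an average over sample points turns information identities into pointwise
identities between fibre sizes. -/
theorem entropy_eq_sum_log (X : Ω → α) :
    entropy X = ∑ ω, (Real.log (Fintype.card Ω) - Real.log (fiberCard X ω)) / Fintype.card Ω := by
  classical
  rw [entropy, ← sum_fiberwise_of_maps_to (s := univ) (t := univ.image X) (g := X)
    (fun ω hω => mem_image_of_mem X hω)]
  refine sum_congr rfl fun x hx => ?_
  obtain ⟨ω, -, rfl⟩ := mem_image.1 hx
  have hΩ : (Fintype.card Ω : ℝ) ≠ 0 := by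
    have : Nonempty Ω := ⟨ω⟩
    exact_mod_cast Fintype.card_ne_zero
  have hpos : (fiberCard X ω : ℝ) ≠ 0 := by exact_mod_cast (fiberCard_pos X ω).ne'
  have hprob : prob {ω' | X ω' = X ω} = fiberCard X ω / Fintype.card Ω := by
    rw [prob, fiberCard, Nat.card_eq_fintype_card, Fintype.card_subtype]
    rfl
  rw [sum_congr rfl (g := fun _ =>
      (Real.log (Fintype.card Ω) - Real.log (fiberCard X ω)) / Fintype.card Ω), sum_const,
    hprob, Real.negMulLog, Real.log_div hpos hΩ, nsmul_eq_mul]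
  · change _ = (fiberCard X ω : ℝ) * _
    ring
  · intro ω' hω'
    rw [fiberCard, fiberCard, (mem_filter.1 hω').2]

theorem entropy_congr (X : Ω → α) (Y : Ω → β) (h : ∀ ω ω', X ω' = X ω ↔ Y ω' = Y ω) :
    entropy X = entropy Y := by
  classical
  rw [entropy_eq_sum_log, entropy_eq_sum_log]
  refine sum_congr rfl fun ω _ => ?_
  simp only [fiberCard, h ω]

theorem condEntropy_eq_zero_of_determined (X : Ω → α) (Y : Ω → β)
    (h : ∀ ω ω', Y ω' = Y ω → X ω' = X ω) : condEntropy X Y = 0 := by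
  rw [condEntropy, sub_eq_zero]
  refine entropy_congr _ _ fun ω ω' => ?_
  simp only [Prod.mk.injEq]
  exact ⟨And.right, fun h' => ⟨h ω ω' h', h'⟩⟩

/-- `I(X ; Y | Z) = 0` as soon as any two values of `X` that are possible together with a value of
`Z` are exchanged by injections that preserve `Y` and `Z`. -/
theorem condMutualInfo_eq_zero_of_exchange (X : Ω → α) (Y : Ω → β) (Z : Ω → γ)
    (h : ∀ ω₀ ω₁, Z ω₁ = Z ω₀ → ∃ e : Ω → Ω, Set.InjOn e {ω | X ω = X ω₀ ∧ Z ω = Z ω₀} ∧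
      ∀ ω, X ω = X ω₀ → Z ω = Z ω₀ → X (e ω) = X ω₁ ∧ Y (e ω) = Y ω ∧ Z (e ω) = Z ω) :
    condMutualInfo X Y Z = 0 := by
  classical
  have hle : ∀ ω₀ ω₁, Z ω₁ = Z ω₀ → ∀ T : Set β,
      #{ω | X ω = X ω₀ ∧ Y ω ∈ T ∧ Z ω = Z ω₀} ≤ #{ω | X ω = X ω₁ ∧ Y ω ∈ T ∧ Z ω = Z ω₀} := by
    intro ω₀ ω₁ hz T
    obtain ⟨e, he, hm⟩ := h ω₀ ω₁ hz
    refine card_le_card_of_injOn e ?_ (he.mono ?_)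
    · intro ω hω
      simp only [coe_filter, mem_univ, true_and, Set.mem_ofPred_eq] at hω ⊢
      obtain ⟨h1, h2, h3⟩ := hm ω hω.1 hω.2.2
      rw [h1, h2, h3]
      exact ⟨rfl, hω.2⟩
    · intro ω hω
      simp only [coe_filter, mem_univ, true_and, Set.mem_ofPred_eq] at hω
      exact ⟨hω.1, hω.2.2⟩
  have heq : ∀ ω₀ ω₁, Z ω₁ = Z ω₀ → ∀ T : Set β,
      #{ω | X ω = X ω₁ ∧ Y ω ∈ T ∧ Z ω = Z ω₀} = #{ω | X ω = X ω₀ ∧ Y ω ∈ T ∧ Z ω = Z ω₀} := by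
    intro ω₀ ω₁ hz T
    refine le_antisymm ?_ (hle ω₀ ω₁ hz T)
    simpa only [hz] using hle ω₁ ω₀ hz.symm T
  -- Inside a fibre of `Z`, all possible values of `X` are equally frequent on `Y ∈ T`. Taking `T`
  -- to be everything and then a single value gives the product rule `hprod`, whose logarithm makes
  -- each summand vanish.
  have hfib : ∀ ω₀, ∀ T : Set β, #{ω | Y ω ∈ T ∧ Z ω = Z ω₀} =
      #(({ω | Z ω = Z ω₀} : Finset Ω).image X) *
        #{ω | X ω = X ω₀ ∧ Y ω ∈ T ∧ Z ω = Z ω₀} := by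
    intro ω₀ T
    rw [card_eq_sum_card_fiberwise (f := X) (t := ({ω | Z ω = Z ω₀} : Finset Ω).image X)]
    · refine sum_const_nat fun x hx => ?_
      obtain ⟨ω₁, h1, rfl⟩ := mem_image.1 hx
      rw [← heq ω₀ ω₁ (mem_filter.1 h1).2 T, filter_filter]
      congr 1
      ext ω
      simp only [mem_filter, mem_univ, true_and]
      tauto
    · intro ω hω
      simp only [coe_filter, mem_univ, true_and, Set.mem_ofPred_eq] at hω
      exact mem_image_of_mem X (by simpa using hω.2)
  have hprod : ∀ ω, (fiberCard (fun ω => (X ω, Z ω)) ω : ℝ) * fiberCard (fun ω => (Y ω, Z ω)) ω =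
      fiberCard Z ω * fiberCard (fun ω => (X ω, Y ω, Z ω)) ω := by
    intro ω
    have h1 := hfib ω Set.univ
    have h2 := hfib ω {Y ω}
    simp only [Set.mem_univ, true_and, Set.mem_singleton_iff] at h1 h2
    simp only [fiberCard, Prod.mk.injEq]
    rw [h1, h2]
    push_cast
    ring
  rw [condMutualInfo, condEntropy, condEntropy, entropy_eq_sum_log, entropy_eq_sum_log,
    entropy_eq_sum_log, entropy_eq_sum_log, ← sum_sub_distrib, ← sum_sub_distrib,
    ← sum_sub_distrib]
  refine sum_eq_zero fun ω _ => ?_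
  have hlog := congrArg Real.log (hprod ω)
  rw [Real.log_mul (by exact_mod_cast (fiberCard_pos _ ω).ne')
      (by exact_mod_cast (fiberCard_pos _ ω).ne'),
    Real.log_mul (by exact_mod_cast (fiberCard_pos _ ω).ne')
      (by exact_mod_cast (fiberCard_pos _ ω).ne')] at hlog
  rw [← sub_div, ← sub_div, ← sub_div, div_eq_zero_iff]
  left
  linarith

theorem mutualInfo_eq_condMutualInfo_unit (X : Ω → α) (Y : Ω → β) :
    mutualInfo X Y = condMutualInfo X Y fun _ => () := by
  have h0 : entropy (fun _ : Ω => ()) = 0 := by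
    rw [entropy_eq_sum_log]
    exact sum_eq_zero fun ω _ => by simp [fiberCard]
  rw [mutualInfo, condMutualInfo, condEntropy, condEntropy, condEntropy, h0,
    entropy_congr (fun ω => (X ω, ())) X (by simp),
    entropy_congr (fun ω => (X ω, Y ω, ())) (fun ω => (X ω, Y ω)) (by simp),
    entropy_congr (fun ω => (Y ω, ())) Y (by simp)]
  ring

/-- `I(X ; Y) = 0` as soon as any two values of `X` are exchanged by injections that preserve `Y`. -/
theorem mutualInfo_eq_zero_of_exchange (X : Ω → α) (Y : Ω → β)
    (h : ∀ ω₀ ω₁, ∃ e : Ω → Ω, Set.InjOn e {ω | X ω = X ω₀} ∧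
      ∀ ω, X ω = X ω₀ → X (e ω) = X ω₁ ∧ Y (e ω) = Y ω) :
    mutualInfo X Y = 0 := by
  rw [mutualInfo_eq_condMutualInfo_unit]
  refine condMutualInfo_eq_zero_of_exchange _ _ _ fun ω₀ ω₁ _ => ?_
  obtain ⟨e, he, hm⟩ := h ω₀ ω₁
  exact ⟨e, he.mono fun ω hω => hω.1, fun ω hω _ => ⟨(hm ω hω).1, (hm ω hω).2, rfl⟩⟩

end Information

/-! ### Security of the scheme realized by an array -/

/-- The bijection between the two ranges extends to a permutation of the finite set `{x // p x}`,
and by the identity outside it. -/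
theorem exists_perm_map_eq {α ι : Type*} [Finite α] (p : α → Prop) {f g : ι → α}
    (hf : Function.Injective f) (hg : Function.Injective g) (hpf : ∀ i, p (f i))
    (hpg : ∀ i, p (g i)) :
    ∃ τ : Equiv.Perm α, (∀ x, p (τ x) ↔ p x) ∧ ∀ i, τ (f i) = g i := by
  classical
  let f' : ι → {x // p x} := fun i => ⟨f i, hpf i⟩
  let g' : ι → {x // p x} := fun i => ⟨g i, hpg i⟩
  have hf' : Function.Injective f' := fun i j h => hf (congrArg Subtype.val h)
  have hg' : Function.Injective g' := fun i j h => hg (congrArg Subtype.val h)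
  let e : {x // x ∈ Set.range f'} ≃ {x // x ∈ Set.range g'} :=
    (Equiv.ofInjective f' hf').symm.trans (Equiv.ofInjective g' hg')
  refine ⟨Equiv.Perm.ofSubtype e.extendSubtype, fun x => ?_, fun i => ?_⟩
  · by_cases hx : p x
    · rw [Equiv.Perm.ofSubtype_apply_of_mem _ hx]
      exact iff_of_true (Subtype.prop _) hx
    · rw [Equiv.Perm.ofSubtype_apply_of_not_mem _ hx]
  · rw [Equiv.Perm.ofSubtype_apply_of_mem _ (hpf i)]
    have h1 : e.extendSubtype (f' i) = e ⟨f' i, i, rfl⟩ := e.extendSubtype_apply_of_mem _ ⟨i, rfl⟩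
    have h2 : (Equiv.ofInjective f' hf').symm ⟨f' i, i, rfl⟩ = i := by
      rw [Equiv.symm_apply_eq]
      rfl
    have h3 : e ⟨f' i, i, rfl⟩ = ⟨g' i, i, rfl⟩ := by
      simp only [e, Equiv.trans_apply, h2]
      rfl
    have h4 : e.extendSubtype ⟨f i, hpf i⟩ = g' i := h1.trans (congrArg Subtype.val h3)
    exact congrArg Subtype.val h4

section Scheme

variable {K F Z S N b : ℕ} {P : PArray K F S} {J : Fin S → Fin F} {R : Fin S → Fin K → Fin F}

open Classical in
/-- The row of the packet of file `n` that takes part in the `s`-th signal. -/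
noncomputable def codedRow (P : PArray K F S) (J : Fin S → Fin F) (R : Fin S → Fin K → Fin F)
    (d : Fin K ↪ Fin N) (s : Fin S) (n : Fin N) : Fin F :=
  if h : ∃ k ∈ columnsOf P s, n = d k then R s h.choose else J s

theorem codedRow_demand (d : Fin K ↪ Fin N) {s : Fin S} {k : Fin K} (hk : k ∈ columnsOf P s) :
    codedRow P J R d s (d k) = R s k := by
  have h : ∃ k' ∈ columnsOf P s, d k = d k' := ⟨k, hk, rfl⟩
  rw [codedRow, dif_pos h, ← d.injective h.choose_spec.2]

theorem codedRow_of_not_demanded (d : Fin K ↪ Fin N) {s : Fin S} {n : Fin N}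
    (h : ∀ k ∈ columnsOf P s, n ≠ d k) : codedRow P J R d s n = J s := by
  rw [codedRow, dif_neg]
  rintro ⟨k, hk, hn⟩
  exact h k hk hn

theorem mem_placed {k : Fin K} {p : Fin N × Fin F} : p ∈ (schemeOf P N).placed k ↔
    P p.2 k = none ∨ ∃ s, P p.2 k = some s ∧ IsKeyRow P s p.2 := by
  simp [schemeOf]

theorem cacheView_perms {k : Fin K} {ω : Sample K N F S b} {n : Fin N} {j : Fin F}
    (h : (n, j) ∈ (schemeOf P N).placed k) :
    (schemeOf P N).cacheView k ω n (ω.perms n j) = some (ω.files n j) := by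
  simp [CachingScheme.cacheView, h]

namespace IsRowSystem

/-- Hence a signal contains exactly one packet of every file, so the mere presence of a file in it
says nothing about the demands. -/
theorem mem_coded (hR : IsRowSystem P J R) (d : Fin K ↪ Fin N) (s : Fin S) (p : Fin N × Fin F) :
    p ∈ (schemeOf P N).coded d s ↔ p.2 = codedRow P J R d s p.1 := by
  obtain ⟨n, j⟩ := p
  simp only [schemeOf, mem_filter, mem_univ, true_and, hR.isKeyRow_iff, hR.eq_some_iff]
  by_cases h : ∃ k ∈ columnsOf P s, n = d k
  · obtain ⟨k, hk, rfl⟩ := h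
    rw [codedRow_demand d hk]
    constructor
    · rintro (⟨k', h1, h2, h3⟩ | ⟨h1, -⟩)
      · rw [d.injective h1]
        exact h2.2.resolve_left h3
      · exact absurd rfl (h1 k hk)
    · rintro rfl
      exact Or.inl ⟨k, rfl, ⟨hk, Or.inr rfl⟩, hR.ne_key s k hk⟩
  · have h' : ∀ k ∈ columnsOf P s, n ≠ d k := fun k hk hn => h ⟨k, hk, hn⟩
    rw [codedRow_of_not_demanded d h']
    constructor
    · rintro (⟨k', h1, h2, h3⟩ | ⟨-, h2⟩)
      · exact absurd h1 (h' k' h2.1)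
      · exact h2
    · exact fun hj => Or.inr ⟨h', hj⟩

theorem signal_eq (hR : IsRowSystem P J R) (s : Fin S) (ω : Sample K N F S b) :
    (schemeOf P N).signal s ω = ∑ n, ω.files n (codedRow P J R ω.demands s n) := by
  rw [CachingScheme.signal]
  refine sum_bij' (fun p _ => p.1) (fun n _ => (n, codedRow P J R ω.demands s n)) ?_ ?_ ?_ ?_ ?_
  · intro p _
    exact mem_univ _
  · intro n _
    exact (hR.mem_coded _ _ _).2 rfl
  · intro p hp
    exact Prod.ext rfl ((hR.mem_coded _ _ _).1 hp).symm
  · intro n _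
    rfl
  · intro p hp
    rw [(hR.mem_coded _ _ _).1 hp]

theorem mem_header (hR : IsRowSystem P J R) (s : Fin S) (ω : Sample K N F S b)
    (p : Fin N × Fin F) : p ∈ (schemeOf P N).header s ω ↔
      p.2 = ω.perms p.1 (codedRow P J R ω.demands s p.1) := by
  obtain ⟨n, i⟩ := p
  simp only [CachingScheme.header, mem_image, hR.mem_coded, Prod.exists, Prod.mk.injEq]
  constructor
  · rintro ⟨n, j, rfl, rfl, rfl⟩
    rfl
  · rintro rfl
    exact ⟨n, _, rfl, rfl, rfl⟩

theorem header_eq_iff (hR : IsRowSystem P J R) (s : Fin S) (ω ω' : Sample K N F S b) :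
    (schemeOf P N).header s ω' = (schemeOf P N).header s ω ↔
      ∀ n, ω'.perms n (codedRow P J R ω'.demands s n) =
        ω.perms n (codedRow P J R ω.demands s n) := by
  constructor
  · intro h n
    have := (hR.mem_header s ω' (n, ω'.perms n (codedRow P J R ω'.demands s n))).2 rfl
    rw [h, hR.mem_header] at this
    exact this
  · intro h
    ext p
    rw [hR.mem_header, hR.mem_header, h]

/-- A file demanded by another member of the group contributes a row with a star in column `k`; a
file not demanded in the group contributes the key row. User `k` caches both. -/
theorem codedRow_mem_placed (hR : IsRowSystem P J R) (d : Fin K ↪ Fin N) {s : Fin S} {k : Fin K}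
    (hk : k ∈ columnsOf P s) {n : Fin N} (hn : n ≠ d k) :
    P (codedRow P J R d s n) k = none ∨ ∃ s', P (codedRow P J R d s n) k = some s' ∧
      IsKeyRow P s' (codedRow P J R d s n) := by
  by_cases h : ∃ k' ∈ columnsOf P s, n = d k'
  · obtain ⟨k', hk', rfl⟩ := h
    rw [codedRow_demand d hk']
    exact Or.inl (hR.star s k' hk' k hk fun h => hn (congrArg d h))
  · rw [codedRow_of_not_demanded d fun k hk hn => h ⟨k, hk, hn⟩]
    exact Or.inr ⟨s, hR.key_eq hk, (hR.isKeyRow_iff s _).2 rfl⟩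

/-- Two diagonal rows for the same demander are told apart in the column of that demander, two key
rows in column `k`, and a diagonal row from a key row by its star in column `k`. -/
theorem codedRow_injective (hR : IsRowSystem P J R) (d : Fin K ↪ Fin N) {k : Fin K} {n : Fin N}
    (hn : n ≠ d k) : Function.Injective fun s : {s // k ∈ columnsOf P s} =>
      codedRow P J R d s.1 n := by
  rintro ⟨s, hs⟩ ⟨s', hs'⟩ h
  simp only at h
  rw [Subtype.mk.injEq]
  by_cases h1 : ∃ k' ∈ columnsOf P s, n = d k' <;> by_cases h2 : ∃ k' ∈ columnsOf P s', n = d k'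
  · obtain ⟨k₁, hk₁, rfl⟩ := h1
    obtain ⟨k₂, hk₂, he⟩ := h2
    obtain rfl := d.injective he
    rw [codedRow_demand d hk₁, codedRow_demand d hk₂] at h
    have h3 := hR.row_eq hk₁
    rw [h, hR.row_eq hk₂] at h3
    exact (Option.some_injective _ h3).symm
  · obtain ⟨k₁, hk₁, rfl⟩ := h1
    rw [codedRow_demand d hk₁, codedRow_of_not_demanded d fun k hk hn => h2 ⟨k, hk, hn⟩] at h
    have h3 := hR.star s k₁ hk₁ k hs fun h => hn (congrArg d h)
    rw [h, hR.key_eq hs'] at h3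
    exact absurd h3 (by simp)
  · obtain ⟨k₂, hk₂, rfl⟩ := h2
    rw [codedRow_demand d hk₂, codedRow_of_not_demanded d fun k hk hn => h1 ⟨k, hk, hn⟩] at h
    have h3 := hR.star s' k₂ hk₂ k hs' fun h => hn (congrArg d h)
    rw [← h, hR.key_eq hs] at h3
    exact absurd h3 (by simp)
  · rw [codedRow_of_not_demanded d fun k hk hn => h1 ⟨k, hk, hn⟩,
      codedRow_of_not_demanded d fun k hk hn => h2 ⟨k, hk, hn⟩] at h
    have h3 := hR.key_eq hs
    rw [h, hR.key_eq hs'] at h3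
    exact (Option.some_injective _ h3).symm

theorem decodable (hR : IsRowSystem P J R) (k : Fin K) : condEntropy
    (fun ω : Sample K N F S b => ω.files (ω.demands k))
    (fun ω => ((schemeOf P N).cacheView k ω, (schemeOf P N).keyView k ω,
      (fun s : (schemeOf P N).SignalOf k =>
        ((schemeOf P N).header s.1 ω, (schemeOf P N).encrypted s.1 ω)),
      ω.perms (ω.demands k), ω.demands k)) = 0 := by
  refine condEntropy_eq_zero_of_determined _ _ fun ω ω' h => ?_
  simp only [Prod.mk.injEq] at h
  obtain ⟨hcache, hkeys, hsig, hperm, hd⟩ := h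
  rw [hd] at hperm ⊢
  -- For files other than the demanded one the permutations may differ between the two samples, so
  -- cached packets are compared by the index they carry and not by their row.
  have hplaced : ∀ n j j', (n, j) ∈ (schemeOf P N).placed k → (n, j') ∈ (schemeOf P N).placed k →
      ω'.perms n j' = ω.perms n j → ω'.files n j' = ω.files n j := by
    intro n j j' hj hj' he
    have h1 := cacheView_perms (ω := ω') hj'
    rw [hcache, he, cacheView_perms hj] at h1
    exact (Option.some_injective _ h1).symm
  funext j
  by_cases hj : (ω.demands k, j) ∈ (schemeOf P N).placed k
  · exact hplaced _ j j hj hj (by rw [hperm])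
  · rw [mem_placed] at hj
    push Not at hj
    obtain ⟨s, hs⟩ := Option.ne_none_iff_exists'.1 hj.1
    have hkey := hj.2 s hs
    obtain ⟨hk, hrow⟩ := (hR.eq_some_iff s j k).1 hs
    rw [hR.isKeyRow_iff] at hkey
    obtain rfl := hrow.resolve_left hkey
    have h1 := congrFun hsig ⟨s, hk⟩
    have h2 : ω'.keys s = ω.keys s := congrFun hkeys ⟨s, hk⟩
    simp only [Prod.mk.injEq, hR.header_eq_iff] at h1
    obtain ⟨hhead, henc⟩ := h1
    -- After removing the common key, the wanted packet is split off; the remaining packets are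
    -- cached and are matched through the header.
    rw [CachingScheme.encrypted, CachingScheme.encrypted, h2, add_left_cancel_iff, hR.signal_eq,
      hR.signal_eq, ← add_sum_erase _ _ (mem_univ (ω.demands k)),
      ← add_sum_erase _ _ (mem_univ (ω.demands k)), codedRow_demand _ hk, ← hd,
      codedRow_demand _ hk] at henc
    rw [← hd]
    refine add_right_cancel (henc.trans ?_)
    congr 1
    refine sum_congr rfl fun n hn => (hplaced n _ _ ?_ ?_ (hhead n)).symm
    · exact mem_placed.2 (hR.codedRow_mem_placed _ hk (hd ▸ ne_of_mem_erase hn))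
    · exact mem_placed.2 (hR.codedRow_mem_placed _ hk (ne_of_mem_erase hn))

/-- For two demand vectors that agree on user `k`, the rows of a file can be permuted, within the
part cached by `k`, so that the signals for the first vector become those for the second one. -/
theorem exists_perm_codedRow (hR : IsRowSystem P J R) {k : Fin K} {d d' : Fin K ↪ Fin N}
    (hd : d' k = d k) (n : Fin N) : ∃ τ : Equiv.Perm (Fin F), (n = d k → τ = 1) ∧
      (∀ j, (n, τ j) ∈ (schemeOf P N).placed k ↔ (n, j) ∈ (schemeOf P N).placed k) ∧
      ∀ s, k ∈ columnsOf P s → τ (codedRow P J R d s n) = codedRow P J R d' s n := by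
  by_cases hn : n = d k
  · subst hn
    refine ⟨1, fun _ => rfl, fun _ => Iff.rfl, fun s hs => ?_⟩
    rw [codedRow_demand d hs, ← hd, codedRow_demand d' hs]
    rfl
  · have hn' : n ≠ d' k := hd ▸ hn
    obtain ⟨τ, h1, h2⟩ := exists_perm_map_eq
      (fun j => P j k = none ∨ ∃ s, P j k = some s ∧ IsKeyRow P s j)
      (hR.codedRow_injective d hn) (hR.codedRow_injective d' hn')
      (fun s => hR.codedRow_mem_placed d s.2 hn) (fun s => hR.codedRow_mem_placed d' s.2 hn')
    refine ⟨τ, fun h => absurd h hn, fun j => ?_, fun s hs => h2 ⟨s, hs⟩⟩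
    rw [mem_placed, mem_placed]
    exact h1 j

theorem privacy (hR : IsRowSystem P J R) (k : Fin K) : condMutualInfo
    (fun ω : Sample K N F S b => fun i : {i : Fin K // i ≠ k} => ω.demands i.1)
    (fun ω => fun s : (schemeOf P N).SignalOf k =>
      ((schemeOf P N).header s.1 ω, (schemeOf P N).signal s.1 ω))
    (fun ω => (ω.perms (ω.demands k), (schemeOf P N).cacheView k ω, ω.demands k)) = 0 := by
  refine condMutualInfo_eq_zero_of_exchange _ _ _ fun ω₀ ω₁ h => ?_
  have hd : ω₁.demands k = ω₀.demands k := congrArg (fun q => q.2.2) h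
  choose τ hτ₁ hτ₂ hτ₃ using fun n => hR.exists_perm_codedRow hd n
  -- Packets and their indices are moved together by `τ`, so each packet keeps its index and its
  -- content while the rows become those coded for the new demands.
  let e : Sample K N F S b → Sample K N F S b := fun ω =>
    (fun n j => ω.files n ((τ n).symm j), fun n => (τ n).symm.trans (ω.perms n), ω.keys, ω₁.demands)
  -- The condition on the other users together with the demand of `k` fixes the whole demand vector;
  -- hence overwriting it does not spoil injectivity of `e`.
  have hdem : ∀ ω : Sample K N F S b,
      (fun i : {i : Fin K // i ≠ k} => ω.demands i.1) = (fun i => ω₀.demands i.1) →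
      ω.demands k = ω₀.demands k → ω.demands = ω₀.demands := by
    intro ω h1 h2
    ext i
    by_cases hi : i = k
    · rw [hi, h2]
    · exact congrArg Fin.val (congrFun h1 ⟨i, hi⟩)
  refine ⟨e, ?_, ?_⟩
  · rintro ω ⟨hX, hZ⟩ ω' ⟨hX', hZ'⟩ he
    have h1 := hdem ω hX (congrArg (fun q => q.2.2) hZ)
    have h2 := hdem ω' hX' (congrArg (fun q => q.2.2) hZ')
    have hfiles : ω.files = ω'.files := by
      funext n j
      have := congrFun (congrFun (congrArg Prod.fst he) n) (τ n j)
      simpa [e] using this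
    have hperms : ω.perms = ω'.perms := by
      funext n
      ext j
      have := congrArg (fun q => (q.2.1 n (τ n j) : ℕ)) he
      simpa [e] using this
    have hkeys : ω.keys = ω'.keys := congrArg (fun q => q.2.2.1) he
    exact Prod.ext hfiles (Prod.ext hperms (Prod.ext hkeys (h1.trans h2.symm)))
  · intro ω hX hZ
    have hω := hdem ω hX (congrArg (fun q => q.2.2) hZ)
    have hfiles : ∀ n j, (e ω).files n (τ n j) = ω.files n j := by
      intro n j
      simp [e, Sample.files]
    have hperms : ∀ n j, (e ω).perms n (τ n j) = ω.perms n j := by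
      intro n j
      simp [e, Sample.perms]
    have hdem' : (e ω).demands = ω₁.demands := rfl
    refine ⟨rfl, ?_, ?_⟩
    · funext s
      have hrow : ∀ n, codedRow P J R (e ω).demands s.1 n =
          τ n (codedRow P J R ω.demands s.1 n) := by
        intro n
        rw [hdem', hω, hτ₃ n s.1 s.2]
      refine Prod.ext ?_ ?_
      · refine (hR.header_eq_iff _ _ _).2 fun n => ?_
        rw [hrow, hperms]
      · change (schemeOf P N).signal s.1 (e ω) = (schemeOf P N).signal s.1 ω
        rw [hR.signal_eq, hR.signal_eq]
        exact sum_congr rfl fun n _ => by rw [hrow, hfiles]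
    · have hk : (e ω).demands k = ω.demands k := by rw [hdem', hω, hd]
      refine Prod.ext ?_ (Prod.ext ?_ hk)
      · change (e ω).perms ((e ω).demands k) = ω.perms (ω.demands k)
        rw [hk]
        ext j
        have := hperms (ω.demands k) j
        rw [hτ₁ _ (by rw [hω])] at this
        exact congrArg Fin.val this
      · funext n i
        obtain ⟨j, rfl⟩ := (ω.perms n).surjective i
        change (schemeOf P N).cacheView k (e ω) n _ = (schemeOf P N).cacheView k ω n _
        by_cases hj : (n, j) ∈ (schemeOf P N).placed k
        · rw [cacheView_perms hj, ← hperms, cacheView_perms ((hτ₂ n j).2 hj), hfiles]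
        · have hj' := mt (hτ₂ n j).1 hj
          rw [CachingScheme.cacheView, CachingScheme.cacheView, Equiv.symm_apply_apply, if_neg hj,
            ← hperms, Equiv.symm_apply_apply, if_neg hj']

end IsRowSystem

/-- Packets are stored and summed by row, so none of these bits involve the permutations, which can
be replaced freely. -/
theorem CachingScheme.perms_hidden_of_independent (C : CachingScheme K N F S) (k : Fin K) :
    mutualInfo (fun ω : Sample K N F S b => ω.perms)
      (fun ω => (C.cacheBits k ω, C.keyView k ω, fun s : C.SignalOf k => C.signal s.1 ω)) = 0 := by
  refine mutualInfo_eq_zero_of_exchange _ _ fun ω₀ ω₁ =>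
    ⟨fun ω => (ω.files, ω₁.perms, ω.keys, ω.demands), ?_, fun ω _ => ⟨rfl, rfl⟩⟩
  intro ω hω ω' hω' he
  have hp : ω.perms = ω'.perms := Eq.trans hω (Eq.symm hω')
  simp only [Prod.mk.injEq, true_and] at he
  exact Prod.ext he.1 (Prod.ext hp (Prod.ext he.2.1 he.2.2))

/-- One-time pad encryption of the signals hides the files, whatever the signals are. -/
theorem CachingScheme.wiretap_of_keys (C : CachingScheme K N F S) :
    mutualInfo (fun ω : Sample K N F S b => ω.files)
      (fun ω => fun s : Fin S => (C.header s ω, C.encrypted s ω)) = 0 := by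
  refine mutualInfo_eq_zero_of_exchange _ _ fun ω₀ ω₁ =>
    -- The new key absorbs the change of the signal, leaving the ciphertext as it was; headers do
    -- not depend on the files.
    ⟨fun ω => (ω₁.files, ω.perms, fun s => ω.keys s + C.signal s ω -
      ∑ p ∈ C.coded ω.demands s, ω₁.files p.1 p.2, ω.demands), ?_, fun ω _ => ⟨rfl, ?_⟩⟩
  · intro ω hω ω' hω' he
    have hf : ω.files = ω'.files := Eq.trans hω (Eq.symm hω')
    simp only [Prod.mk.injEq, true_and] at he
    obtain ⟨hp, hs, hd⟩ := he
    have hk : ω.keys = ω'.keys := by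
      funext s
      have := congrFun hs s
      simpa [CachingScheme.signal, hf, hd] using this
    exact Prod.ext hf (Prod.ext hp (Prod.ext hk hd))
  · funext s
    refine Prod.ext rfl ?_
    exact sub_add_cancel _ _

/-- Each column has `(F - Z) / 2` symbols, so a user caches `Z + (F - Z) / 2 = (F + Z) / 2` packets
per file and holds `(F - Z) / 2` keys. -/
theorem IsSPDA.isSecure (hP : IsSPDA K F Z S P) (hZF : Z < F) (hN : 0 < N)
    (hinj : Function.Injective (columnsOf P)) :
    (schemeOf P N).IsSecure b (N * ((F + Z) / (2 * F))) (S / F) := by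
  obtain ⟨J, R, hR⟩ := hP.exists_isRowSystem
  have hF : (0 : ℝ) < F := by exact_mod_cast hP.pos_F
  have hN' : (0 : ℝ) < N := by exact_mod_cast hN
  have hZF' : (Z : ℝ) < F := by exact_mod_cast hZF
  have hcount : ∀ k, (F : ℝ) = Z + 2 * #{s | k ∈ columnsOf P s} := fun k => by
    exact_mod_cast hR.card_rows hP k
  refine ⟨fun k => ?_, by positivity, ?_, rfl, hinj, fun k => ?_, hR.decodable, hR.privacy,
    CachingScheme.perms_hidden_of_independent _, CachingScheme.wiretap_of_keys _⟩
  · have hplaced : (schemeOf P N).placed k = univ ×ˢ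
        ({j | P j k = none ∨ ∃ s, P j k = some s ∧ IsKeyRow P s j} : Finset (Fin F)) := by
      ext p
      rw [mem_placed]
      simp
    rw [CachingScheme.cacheSize, hplaced, card_product, hR.card_cached_rows hP, card_univ,
      Fintype.card_fin]
    have := hcount k
    push_cast
    field_simp
    linarith
  · have : ((F : ℝ) + Z) / (2 * F) < 1 := by
      rw [div_lt_one (by positivity)]
      linarith
    nlinarith
  · have hcard : Fintype.card ((schemeOf P N).SignalOf k) = #{s | k ∈ columnsOf P s} :=
      Fintype.card_subtype _
    have := hcount k
    rw [hcard, mul_div_cancel_left₀ _ hN'.ne']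
    field_simp
    linarith

end Scheme

/-! ### The stacked array -/

section Stacked

variable {K t : ℕ} {D : Fin ((K - 1).choose t) → Finset (Finset (Fin K))}

theorem parallelArray_eq_some_iff (hD : IsParallelClasses K t D) (i : Fin ((K - 1).choose t))
    (k : Fin K) (B : Sub K (t + 1)) :
    parallelArray K t D i k = some B ↔ B.1 ∈ D i ∧ k ∈ B.1 := by
  obtain ⟨B₀, hB₀, hk₀⟩ := hD.cover i k
  have h : ∃ B : Sub K (t + 1), B.1 ∈ D i ∧ k ∈ B.1 := ⟨⟨B₀, hD.card_eq i B₀ hB₀⟩, hB₀, hk₀⟩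
  rw [parallelArray, dif_pos h, Option.some_inj]
  constructor
  · rintro rfl
    exact h.choose_spec
  · rintro ⟨h1, h2⟩
    by_contra hne
    exact disjoint_left.1 (hD.disjoint i _ h.choose_spec.1 _ h1 fun h' => hne (Subtype.ext h'))
      h.choose_spec.2 h2

theorem parallelArray_ne_none (hD : IsParallelClasses K t D) (i : Fin ((K - 1).choose t))
    (k : Fin K) : parallelArray K t D i k ≠ none := by
  obtain ⟨B, hB, hk⟩ := hD.cover i k
  rw [(parallelArray_eq_some_iff hD i k ⟨B, hD.card_eq i B hB⟩).2 ⟨hB, hk⟩]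
  simp

theorem subsetArray_eq_some_iff (A : Sub K t) (k : Fin K) (B : Sub K (t + 1)) :
    subsetArray K t A k = some B ↔ k ∈ B.1 ∧ A.1 = B.1.erase k := by
  rw [subsetArray]
  split_ifs with h
  · simp only [false_iff]
    rintro ⟨-, h'⟩
    rw [h'] at h
    simp at h
  · rw [Option.some_inj, Subtype.ext_iff]
    constructor
    · rintro h'
      rw [← h']
      exact ⟨mem_insert_self _ _, (erase_insert h).symm⟩
    · rintro ⟨h1, h2⟩
      simp [h2, insert_erase h1]

theorem subsetArray_eq_none_iff (A : Sub K t) (k : Fin K) :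
    subsetArray K t A k = none ↔ k ∈ A.1 := by
  rw [subsetArray]
  split_ifs with h <;> simp [h]

theorem card_sub (K m : ℕ) : Fintype.card (Sub K m) = K.choose m := by
  rw [Fintype.card_finset_len, Fintype.card_fin]

theorem card_sub_mem (ht : 0 < t) (k : Fin K) :
    #{A : Sub K t | k ∈ A.1} = (K - 1).choose (t - 1) := by
  have h1 : #{A : Sub K t | ¬ k ∈ A.1} = (K - 1).choose t := by
    have : #{A : Sub K t | ¬ k ∈ A.1} = #(powersetCard t (univ.erase k)) := by
      refine card_bij (fun A _ => A.1) ?_ ?_ ?_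
      · intro A hA
        rw [mem_powersetCard, subset_erase]
        exact ⟨⟨subset_univ _, (mem_filter.1 hA).2⟩, A.2⟩
      · intro A _ A' _ h
        exact Subtype.ext h
      · intro A hA
        rw [mem_powersetCard, subset_erase] at hA
        exact ⟨⟨A, hA.2⟩, mem_filter.2 ⟨mem_univ _, hA.1.2⟩, rfl⟩
    rw [this, card_powersetCard, card_erase_of_mem (mem_univ k), card_univ, Fintype.card_fin]
  have h2 := card_filter_add_card_filter_not (s := (univ : Finset (Sub K t))) (fun A => k ∈ A.1)
  rw [h1, card_univ, card_sub] at h2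
  have hK : 0 < K := k.pos
  obtain ⟨x, rfl⟩ : ∃ x, K = x + 1 := ⟨K - 1, by omega⟩
  obtain ⟨y, rfl⟩ : ∃ y, t = y + 1 := ⟨t - 1, by omega⟩
  rw [Nat.choose_succ_succ'] at h2
  simp only [Nat.add_sub_cancel] at h2 ⊢
  omega

variable {F S : ℕ} {r : StackRow K t ≃ Fin F} {σ : Sub K (t + 1) ≃ Fin S}

theorem stackedArray_inl_eq_some_iff (hD : IsParallelClasses K t D)
    (i : Fin ((K - 1).choose t)) (k : Fin K) (s : Fin S) :
    stackedArray K t D r σ (r (Sum.inl i)) k = some s ↔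
      (σ.symm s).1 ∈ D i ∧ k ∈ (σ.symm s).1 := by
  rw [← parallelArray_eq_some_iff hD, stackedArray, Equiv.symm_apply_apply, Sum.elim_inl,
    Option.map_eq_some_iff]
  constructor
  · rintro ⟨B, h, rfl⟩
    rw [Equiv.symm_apply_apply, h]
  · intro h
    exact ⟨_, h, σ.apply_symm_apply s⟩

theorem stackedArray_inr_eq_some_iff (A : Sub K t) (k : Fin K) (s : Fin S) :
    stackedArray K t D r σ (r (Sum.inr A)) k = some s ↔
      k ∈ (σ.symm s).1 ∧ A.1 = (σ.symm s).1.erase k := by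
  rw [← subsetArray_eq_some_iff, stackedArray, Equiv.symm_apply_apply, Sum.elim_inr,
    Option.map_eq_some_iff]
  constructor
  · rintro ⟨B, h, rfl⟩
    rw [Equiv.symm_apply_apply, h]
  · intro h
    exact ⟨_, h, σ.apply_symm_apply s⟩

theorem stackedArray_inr_eq_none_iff (A : Sub K t) (k : Fin K) :
    stackedArray K t D r σ (r (Sum.inr A)) k = none ↔ k ∈ A.1 := by
  rw [← subsetArray_eq_none_iff, stackedArray, Equiv.symm_apply_apply, Sum.elim_inr,
    Option.map_eq_none_iff]

theorem stackedArray_inl_ne_none (hD : IsParallelClasses K t D) (i : Fin ((K - 1).choose t))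
    (k : Fin K) : stackedArray K t D r σ (r (Sum.inl i)) k ≠ none := by
  rw [stackedArray, Equiv.symm_apply_apply, Sum.elim_inl, ne_eq, Option.map_eq_none_iff]
  exact parallelArray_ne_none hD i k

/-- In particular the groups are pairwise different, since different symbols are different subsets.
-/
theorem columnsOf_stackedArray (hD : IsParallelClasses K t D) (s : Fin S) :
    columnsOf (stackedArray K t D r σ) s = (σ.symm s).1 := by
  ext k
  simp only [columnsOf, mem_filter, mem_univ, true_and]
  constructor
  · rintro ⟨j, hj⟩
    obtain ⟨i | A, rfl⟩ := r.surjective j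
    · exact ((stackedArray_inl_eq_some_iff hD i k s).1 hj).2
    · exact ((stackedArray_inr_eq_some_iff A k s).1 hj).1
  · intro hk
    obtain ⟨i, hi, -⟩ := hD.partition _ (σ.symm s).2
    exact ⟨r (Sum.inl i), (stackedArray_inl_eq_some_iff hD i k s).2 ⟨hi, hk⟩⟩

theorem card_stars_stackedArray (ht : 0 < t) (hD : IsParallelClasses K t D) (k : Fin K) :
    #{j | stackedArray K t D r σ j k = none} = (K - 1).choose (t - 1) := by
  rw [← card_sub_mem ht k]
  refine (card_bij (fun A _ => r (Sum.inr A)) ?_ ?_ ?_).symm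
  · intro A hA
    exact mem_filter.2 ⟨mem_univ _, (stackedArray_inr_eq_none_iff A k).2 (mem_filter.1 hA).2⟩
  · intro A _ A' _ h
    exact Sum.inr_injective (r.injective h)
  · intro j hj
    have hj := (mem_filter.1 hj).2
    obtain ⟨i | A, rfl⟩ := r.surjective j
    · exact absurd hj (stackedArray_inl_ne_none hD i k)
    · exact ⟨A, mem_filter.2 ⟨mem_univ _, (stackedArray_inr_eq_none_iff A k).1 hj⟩, rfl⟩

theorem stackedArray_isSPDA (hK : 0 < K) (ht : 0 < t) (hD : IsParallelClasses K t D)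
    (hF : 0 < F) :
    IsSPDA K F ((K - 1).choose (t - 1)) S (stackedArray K t D r σ) := by
  refine ⟨hK, hF, card_stars_stackedArray ht hD, fun s => ?_, fun s => ?_⟩
  · obtain ⟨i, hi, -⟩ := hD.partition _ (σ.symm s).2
    let lower : {k // k ∈ (σ.symm s).1} → Sub K t := fun k =>
      ⟨(σ.symm s).1.erase k.1, by rw [card_erase_of_mem k.2, (σ.symm s).2, Nat.add_sub_cancel]⟩
    let f : {k // k ∈ (σ.symm s).1} ⊕ {k // k ∈ (σ.symm s).1} → Fin F × Fin K :=
      Sum.elim (fun k => (r (Sum.inl i), k.1)) fun k => (r (Sum.inr (lower k)), k.1)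
    have hf : Function.Injective f := by
      rintro (k | k) (k' | k') h <;> simp only [f, Sum.elim_inl, Sum.elim_inr, Prod.mk.injEq,
        EmbeddingLike.apply_eq_iff_eq, reduceCtorEq, false_and] at h
      · rw [Subtype.ext h.2]
      · rw [Subtype.ext h.2]
    calc 4 ≤ Fintype.card ({k // k ∈ (σ.symm s).1} ⊕ {k // k ∈ (σ.symm s).1}) := by
          rw [Fintype.card_sum, Fintype.card_coe, (σ.symm s).2]
          omega
      _ = #(univ.image f) := by rw [card_image_of_injective _ hf, card_univ]
      _ ≤ _ := by
          refine card_le_card fun p hp => mem_filter.2 ⟨mem_univ _, ?_⟩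
          obtain ⟨k | k, -, rfl⟩ := mem_image.1 hp
          · exact (stackedArray_inl_eq_some_iff hD i k.1 s).2 ⟨hi, k.2⟩
          · exact (stackedArray_inr_eq_some_iff _ k.1 s).2 ⟨k.2, rfl⟩
  · obtain ⟨i, hi, hi'⟩ := hD.partition _ (σ.symm s).2
    set B := σ.symm s with hB
    let c : Fin (t + 1) → Fin K := B.1.orderEmbOfFin B.2
    have hc : Function.Injective c := (B.1.orderEmbOfFin B.2).injective
    have hcB : ∀ l, c l ∈ B.1 := fun l => orderEmbOfFin_mem _ _ l
    have hrange : ∀ k, k ∈ B.1 ↔ ∃ l, c l = k := by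
      intro k
      rw [← mem_coe, ← range_orderEmbOfFin B.1 B.2]
      rfl
    let ρ : Fin (t + 1) → Sub K t := fun l =>
      ⟨B.1.erase (c l), by rw [card_erase_of_mem (hcB l), B.2, Nat.add_sub_cancel]⟩
    -- The constant row is the unique class containing `B`; the diagonal row for `c l` is `B`
    -- without `c l`, whose stars stand exactly on its own elements.
    refine ⟨t + 1, r (Sum.inl i), fun l => r (Sum.inr (ρ l)), c, ?_, hc, ?_, ?_, ?_, ?_, ?_, ?_⟩
    · intro l l' h
      have h1 : B.1.erase (c l) = B.1.erase (c l') :=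
        congrArg Subtype.val (Sum.inr_injective (r.injective h))
      exact hc ((erase_injOn B.1) (hcB l) (hcB l') h1)
    · rintro ⟨l, hl⟩
      exact absurd (r.injective hl) (by simp)
    · ext j
      constructor
      · rintro ⟨k, hk⟩
        obtain ⟨i₁ | A, rfl⟩ := r.surjective j
        · left
          rw [hi' i₁ ((stackedArray_inl_eq_some_iff hD i₁ k s).1 hk).1]
        · right
          obtain ⟨h1, h2⟩ := (stackedArray_inr_eq_some_iff A k s).1 hk
          obtain ⟨l, rfl⟩ := (hrange k).1 h1
          exact ⟨l, congrArg (fun A => r (Sum.inr A)) (Subtype.ext h2.symm)⟩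
      · rintro (rfl | ⟨l, rfl⟩)
        · exact ⟨c 0, (stackedArray_inl_eq_some_iff hD i _ s).2 ⟨hi, hcB 0⟩⟩
        · exact ⟨c l, (stackedArray_inr_eq_some_iff _ _ s).2 ⟨hcB l, rfl⟩⟩
    · ext k
      have := columnsOf_stackedArray (r := r) (σ := σ) hD s
      rw [Finset.ext_iff] at this
      have := this k
      simp only [columnsOf, mem_filter, mem_univ, true_and] at this
      exact this.trans (hrange k)
    · exact fun l => (stackedArray_inl_eq_some_iff hD i _ s).2 ⟨hi, hcB l⟩
    · exact fun l => (stackedArray_inr_eq_some_iff _ _ s).2 ⟨hcB l, rfl⟩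
    · intro l l' hne
      exact (stackedArray_inr_eq_none_iff _ _).2
        (mem_erase.2 ⟨fun h => hne (hc h).symm, hcB l'⟩)

end Stacked

/-! ### Parameters of the stacked array and equality in the bound -/

/-- The binomial coefficients in the parameters of the stacked array, in terms of `K.choose t`. -/
theorem choose_parameters {K t : ℕ} (ht : 0 < t) (htK : t < K) :
    ((K - 1).choose t : ℝ) = K.choose t * (K - t) / K ∧
      ((K - 1).choose (t - 1) : ℝ) = K.choose t * t / K ∧
      (K.choose (t + 1) : ℝ) = K.choose t * (K - t) / (t + 1) := by
  have hK : (0 : ℝ) < K := by exact_mod_cast ht.trans htK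
  have h1 : ((K - 1).choose t : ℝ) * K = K.choose t * (K - t) := by
    obtain ⟨x, rfl⟩ : ∃ x, K = x + 1 := ⟨K - 1, by omega⟩
    rw [← Nat.cast_sub htK.le]
    exact_mod_cast Nat.choose_mul_succ_eq x t
  have h2 : ((K - 1).choose (t - 1) : ℝ) + (K - 1).choose t = K.choose t := by
    obtain ⟨x, rfl⟩ : ∃ x, K = x + 1 := ⟨K - 1, by omega⟩
    obtain ⟨y, rfl⟩ : ∃ y, t = y + 1 := ⟨t - 1, by omega⟩
    rw [Nat.choose_succ_succ' x y]
    push_cast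
    simp
  have h3 : (K.choose (t + 1) : ℝ) * (t + 1) = K.choose t * (K - t) := by
    rw [← Nat.cast_sub htK.le]
    exact_mod_cast Nat.choose_succ_right_eq K t
  refine ⟨?_, ?_, ?_⟩
  · rwa [eq_div_iff hK.ne']
  · rw [eq_div_iff hK.ne']
    linear_combination (K : ℝ) * h2 - h1
  · rwa [eq_div_iff (by positivity)]

end SecureCaching

theorem mainTheorem4 (K t : ℕ) (hK : 0 < K) (ht : 0 < t) (hdiv : (t + 1) ∣ K) :
    ∃ F : ℕ, (F : ℝ) = (2 * (K : ℝ) - t) / ((K : ℝ) - t) * ((K - 1).choose t : ℝ) ∧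
      Nonempty (SecureCaching.StackRow K t ≃ Fin F) ∧
      Nonempty (SecureCaching.Sub K (t + 1) ≃ Fin (K.choose (t + 1))) ∧
      (∃ D, SecureCaching.IsParallelClasses K t D) ∧
      ∀ D, SecureCaching.IsParallelClasses K t D →
        ∀ (r : SecureCaching.StackRow K t ≃ Fin F)
          (σ : SecureCaching.Sub K (t + 1) ≃ Fin (K.choose (t + 1))),
          SecureCaching.IsOptimalSPDA K F ((K - 1).choose (t - 1)) (K.choose (t + 1))
            (SecureCaching.stackedArray K t D r σ) ∧
          SecureCaching.spdaLowerBound K F ((K - 1).choose (t - 1)) = (K.choose (t + 1) : ℝ) ∧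
          ∀ N b : ℕ, K ≤ N → 0 < b → ∃ M R : ℝ,
            (SecureCaching.schemeOf (SecureCaching.stackedArray K t D r σ) N).IsSecure b M R ∧
            M / N = (K : ℝ) / (2 * (K : ℝ) - t) ∧
            R = ((K : ℝ) - t) / ((t : ℝ) + 1) * ((K : ℝ) / (2 * (K : ℝ) - t)) := by
  have htK : t < K := Nat.le_of_dvd hK hdiv
  obtain ⟨h1, h2, h3⟩ := SecureCaching.choose_parameters ht htK
  have hK' : (0 : ℝ) < K := by exact_mod_cast hK
  have htK' : (0 : ℝ) < (K : ℝ) - t := sub_pos.2 (by exact_mod_cast htK)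
  have h2K : (0 : ℝ) < 2 * (K : ℝ) - t := by linarith
  have ht' : (0 : ℝ) < t + 1 := by positivity
  have hc : (0 : ℝ) < K.choose t := by exact_mod_cast Nat.choose_pos htK.le
  have hF : (((K - 1).choose t + K.choose t : ℕ) : ℝ) = K.choose t * (2 * K - t) / K := by
    push_cast
    rw [h1]
    field_simp
    ring
  have hFpos : 0 < (K - 1).choose t + K.choose t := by
    have := Nat.choose_pos htK.le
    omega
  have hbound : SecureCaching.spdaLowerBound K ((K - 1).choose t + K.choose t)
      ((K - 1).choose (t - 1)) = (K.choose (t + 1) : ℝ) := by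
    -- Here `F - Z` is twice `(K - 1).choose t` and `F + Z` is twice `K.choose t`, so the
    -- denominator of the bound collapses to `2 * (t + 1)`.
    have hsub : (K.choose t : ℝ) * (2 * K - t) / K - K.choose t * t / K =
        2 * K.choose t * (K - t) / K := by
      field_simp
      ring
    have hadd : (K.choose t : ℝ) * (2 * K - t) / K + K.choose t * t / K = 2 * K.choose t := by
      field_simp
      ring
    have hden : 2 + 2 * (K : ℝ) - 2 * K * (2 * K.choose t * (K - t) / K) / (2 * K.choose t) =
        2 * (t + 1) := by
      field_simp
      ring
    rw [SecureCaching.spdaLowerBound, hF, h2, h3, hsub, hadd, hden]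
    field_simp
  refine ⟨(K - 1).choose t + K.choose t, ?_, ?_, ?_,
    SecureCaching.exists_isParallelClasses hK hdiv, ?_⟩
  · rw [hF, h1]
    field_simp
  · exact ⟨Fintype.equivFinOfCardEq (by
      rw [Fintype.card_sum, Fintype.card_fin, SecureCaching.card_sub])⟩
  · exact ⟨Fintype.equivFinOfCardEq (SecureCaching.card_sub K (t + 1))⟩
  intro D hD r σ
  have hP := SecureCaching.stackedArray_isSPDA (r := r) (σ := σ) hK ht hD hFpos
  refine ⟨⟨hP, fun S' P' hP' => ?_⟩, hbound, fun N b hN _ => ?_⟩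
  · have := hP'.spdaLowerBound_le
    rw [hbound] at this
    exact_mod_cast this
  · have hN0 : 0 < N := hK.trans_le hN
    have hN' : (0 : ℝ) < N := by exact_mod_cast hN0
    have hZF : (K - 1).choose (t - 1) < (K - 1).choose t + K.choose t := by
      have hlt : ((K - 1).choose (t - 1) : ℝ) < ((K - 1).choose t + K.choose t : ℕ) := by
        rw [hF, h2]
        gcongr
        linarith
      exact_mod_cast hlt
    refine ⟨_, _, hP.isSecure hZF hN0 fun s s' h => ?_, ?_, ?_⟩
    · rw [SecureCaching.columnsOf_stackedArray hD, SecureCaching.columnsOf_stackedArray hD] at h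
      exact σ.symm.injective (Subtype.ext h)
    · rw [mul_div_cancel_left₀ _ hN'.ne', hF, h2]
      field_simp
      ring
    · rw [hF, h3]
      field_simp
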